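/- Let $n\ge 2$, let $u,h\in\mathbb R^n$, and let $\mu=\mu_{u,h}$ be the probability measure on $\{-1,1\}^n$ with $\mu(x)\propto\exp\left(\tfrac12\langle u,x\rangle^2+\langle h,x\rangle\right)$. Let $P_\mu$ be the transition matrix of the Glauber dynamics of $\mu$: a coordinate $i\in[n]$ is chosen uniformly at random and $x_i$ is resampled from the conditional distribution of $\mu$ given $(x_j)_{j\ne i}$. Identify $x\in\{-1,1\}^n$ with the $n$-element subset $\{i: x_i=1\}\cup\{\bar i: x_i=-1\}$ of the $2n$-element set $[n]\cup[\bar n]$, and thereby probability measures on $\{-1,1\}^n$ with probability measures on the $n$-element subsets of $[n]\cup[\bar n]$. Let $D=D_{n\to n-1}$ be the down operator, $D(S,T)=\tfrac1n$ if $T\subseteq S$ and $D(S,T)=0$ otherwise, for $|S|=n$ and $|T|=n-1$. Measures are row vectors, and $D_{\mathrm{KL}}$ is the relative entropy (with natural logarithm). Then for every probability measure $\nu$ on $\{-1,1\}^n$, $$D_{\mathrm{KL}}(\nu P_\mu\,\|\,\mu P_\mu)\;\le\; D_{\mathrm{KL}}(\nu D\,\|\,\mu D)\;\le\;\left(1-\frac{1-\|u\|_2^2}{n}\right)D_{\mathrm{KL}}(\nu\,\|\,\mu).$$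 Moreover, let the modified log-Sobolev constant of $P_\mu$ be $$\rho_0(P_\mu)=\inf\left\{\frac{\mathcal E_{P_\mu}(f,\log f)}{2\,\mathrm{Ent}_\mu[f]}\;:\; f:\{-1,1\}^n\to\mathbb R_{\ge0},\ \mathrm{Ent}_\mu[f]\ne0\right\},$$ where $\mathcal E_{P}(f,g)=\langle f,(I-P)g\rangle_\mu$ (with $\log 0=-\infty$ and $0\cdot(\pm\infty)=0$) and $\mathrm{Ent}_\mu[f]=\mathbb E_\mu[f\log f]-\mathbb E_\mu[f]\log\mathbb E_\mu[f]$. Then $$\rho_0(P_\mu)\;\ge\;\frac{1-\|u\|_2^2}{2n},$$ that is, $\mathcal E_{P_\mu}(f,\log f)\ge\frac{1-\|u\|_2^2}{n}\,\mathrm{Ent}_\mu[f]$ for all $f\ge0$. -/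

import Mathlib

open scoped NNReal ENNReal

noncomputable section

namespace RankOneIsing

/-! ### Relative entropy, entropy and the modified log-Sobolev constant on a finite set -/

section Finite

variable {Ω : Type*} [Fintype Ω]

/-- Relative entropy `D_KL(ν ‖ μ) = ∑ x, ν x log (ν x / μ x)` of mass functions on a finite set,
with value `∞` when `ν` is not absolutely continuous with respect to `μ`. -/
def relEntropy (ν μ : Ω → ℝ) : EReal :=
  open Classical in
  if ∀ x, μ x = 0 → ν x = 0 then ((∑ x, ν x * Real.log (ν x / μ x) : ℝ) : EReal) else ⊤

/-- `Ent_μ[f] = E_μ[f log f] - E_μ[f] log E_μ[f]`, with `0 log 0 = 0`. -/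
def entropy (μ : Ω → ℝ) (f : Ω → ℝ≥0) : ℝ :=
  ∑ x, μ x * ((f x : ℝ) * Real.log (f x)) -
    (∑ x, μ x * (f x : ℝ)) * Real.log (∑ x, μ x * (f x : ℝ))

/-- The Dirichlet form `E_P(f, log f) = ⟨f, (I - P) log f⟩_μ` for `f ≥ 0`, as an extended real:
here `log 0 = -∞`, and `0 · (±∞) = 0`. -/
def dirichletLog (μ : Ω → ℝ) (P : Matrix Ω Ω ℝ) (f : Ω → ℝ≥0) : EReal :=
  ∑ x, ((μ x * (f x : ℝ) : ℝ) : EReal) *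
    (ENNReal.log (f x : ℝ≥0∞) - ∑ y, ((P x y : ℝ) : EReal) * ENNReal.log (f y : ℝ≥0∞))

/-- The modified log-Sobolev constant
`ρ₀(P) = inf { E_P(f, log f) / (2 Ent_μ[f]) : f ≥ 0, Ent_μ[f] ≠ 0 }`
of a chain `P` with stationary distribution `μ`. -/
def mlsiConstant (μ : Ω → ℝ) (P : Matrix Ω Ω ℝ) : EReal :=
  ⨅ (f : Ω → ℝ≥0) (_ : entropy μ f ≠ 0),
    dirichletLog μ P f / ((2 * entropy μ f : ℝ) : EReal)

end Finite

/-! ### Homogenization and the down operator -/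

/-- The down operator `D_{k → l}` from the `k`-subsets to the `l`-subsets of `α`, as a
row-stochastic matrix (for `l ≤ k`). -/
def downOp (α : Type*) [DecidableEq α] (k l : ℕ) :
    Matrix {S : Finset α // S.card = k} {T : Finset α // T.card = l} ℝ :=
  fun S T => if T.1 ⊆ S.1 then 1 / (k.choose l : ℝ) else 0

/-- The discrete hypercube `{-1, 1}ⁿ`; `ℤˣ = {1, -1}`. -/
abbrev Cube (n : ℕ) : Type := Fin n → ℤˣ

/-- `σ^hom = {i : σ i = 1} ∪ {ī : σ i = -1}`; the ground set `[n] ∪ [n̄]` is `Fin n ⊕ Fin n`,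
with `ī` being `Sum.inr i`. -/
def homSet {n : ℕ} (σ : Cube n) : Finset (Fin n ⊕ Fin n) :=
  (Finset.univ.filter fun i => σ i = 1).disjSum (Finset.univ.filter fun i => σ i = -1)

lemma card_homSet {n : ℕ} (σ : Cube n) : (homSet σ).card = n := by
  have h : (Finset.univ.filter fun i => σ i = -1) = Finset.univ.filter fun i => ¬ σ i = 1 := by
    ext i
    rcases Int.units_eq_one_or (σ i) with h | h <;> simp [h]
  rw [homSet, Finset.card_disjSum, h, Finset.card_filter_add_card_filter_not]
  simp

/-- The homogenization `m^hom` of a mass function `m` on the cube: the mass function on the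
`n`-subsets of `[n] ∪ [n̄]` with `m^hom(σ^hom) = m(σ)`, and `0` off the sets `σ^hom`. -/
def homogenize {n : ℕ} (m : Cube n → ℝ) :
    {S : Finset (Fin n ⊕ Fin n) // S.card = n} → ℝ :=
  fun S => ∑ σ : Cube n, if (⟨homSet σ, card_homSet σ⟩ : {S // Finset.card S = n}) = S then m σ
    else 0

/-- `m D_{n → n-1}`, for a mass function `m` on the cube viewed as a homogeneous one. -/
def downDist {n : ℕ} (m : Cube n → ℝ) :
    {T : Finset (Fin n ⊕ Fin n) // T.card = n - 1} → ℝ :=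
  Matrix.vecMul (homogenize m) (downOp (Fin n ⊕ Fin n) n (n - 1))

/-! ### The rank-one Ising model and its Glauber dynamics -/

/-- A point of the cube as a vector of `ℝⁿ`. -/
def toVec {n : ℕ} (x : Cube n) : EuclideanSpace ℝ (Fin n) :=
  WithLp.toLp 2 fun i => ((x i : ℤ) : ℝ)

/-- The weight `exp (⟨u, x⟩² / 2 + ⟨h, x⟩)`. -/
def isingWeight {n : ℕ} (u h : EuclideanSpace ℝ (Fin n)) (x : Cube n) : ℝ :=
  Real.exp ((1 / 2) * inner ℝ u (toVec x) ^ 2 + inner ℝ h (toVec x))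

/-- The rank-one Ising model `μ_{u,h}`. -/
def ising {n : ℕ} (u h : EuclideanSpace ℝ (Fin n)) (x : Cube n) : ℝ :=
  isingWeight u h x / ∑ y, isingWeight u h y

/-- The transition matrix of the Glauber dynamics for a positive mass function `m` on the cube:
choose a coordinate `i` uniformly at random and resample `x i` from the conditional distribution
of `m` given the other coordinates of `x`. -/
def glauber {n : ℕ} (m : Cube n → ℝ) : Matrix (Cube n) (Cube n) ℝ :=
  fun x y => (1 / (n : ℝ)) * ∑ i : Fin n,
    if ∀ j, j ≠ i → y j = x j then m y / ∑ s : ℤˣ, m (Function.update x i s) else 0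

end RankOneIsing

end

/-! All three conclusions follow from approximate tensorization of entropy, `wEnt_ising_le`: the
edge entropies over the n directions sum to at least (1 - ‖u‖²) times the full entropy. With f =
dν/dμ, the edge entropy in direction i is D(ν‖μ) minus the relative entropy left after forgetting
x_i, so averaging over i gives the contraction under the down operator. The Glauber inequality is
data processing, and concavity of log bounds the Dirichlet form below by the mean edge entropy.

For tensorization, put a = ⟨u, x⟩ and tilt the product weight exp ⟨h, x⟩ by exp(τ a²/2 + θ a). At τ
= 0 the weight is a product for every θ and entropy tensorizes with constant 1 (`wEnt_pi_le`); τ =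
1, θ = 0 is the Ising weight. Tilted sums solve the heat equation ∂_τ = ½ ∂_θ². The entropy E of f
satisfies ∂_τ E = ½ ∂_θ² E + Δ²/(2W), where W is the mass of f and Δ is W times the displacement of
the mean of a caused by f (`parabolicDerivs_entFlow`). If every tilt at time τ gives a variance at
most K, then Δ²/W ≤ 2KE (`sq_mean_shift_le`). The variance solves ∂_τ V = ½ V'' + m V' + V², m being
the mean of a, so V ≤ s = ‖u‖² at τ = 0 gives V ≤ s/(1 - τ s) for s < 1 (`variance_flow_le`). Hence
the sum of the edge entropies minus (1 - τ s) E is a supersolution of the heat equation, nonnegative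
at τ = 0, and `parabolic_max_principle` carries its sign to τ = 1 (`entFlow_one_le`). -/

namespace RankOneIsing

/-! ### Entropy with respect to an unnormalized weight -/

section WeightedEntropy

variable {Ω A B : Type*} [Fintype Ω] [Fintype A] [Fintype B]

/-- The entropy of `f` with respect to the weight `p`, not assumed to be normalized. -/
noncomputable def wEnt (p f : Ω → ℝ) : ℝ :=
  ∑ x, p x * (f x * Real.log (f x)) -
    (∑ x, p x * f x) * Real.log ((∑ x, p x * f x) / ∑ x, p x)

/-- The tangent line bound for t log t at t = m, with t = 0 allowed. Gibbs' inequality is its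
weighted sum. -/
lemma sub_le_mul_log_sub {t m : ℝ} (ht : 0 ≤ t) (hm : 0 < m) :
    t - m ≤ t * Real.log t - t * Real.log m := by
  rcases ht.eq_or_lt with rfl | ht
  · simp [hm.le]
  · have h := Real.one_sub_inv_le_log_of_pos (div_pos ht hm)
    rw [Real.log_div ht.ne' hm.ne'] at h
    have h2 := mul_le_mul_of_nonneg_left h ht.le
    have : t * (1 - (t / m)⁻¹) = t - m := by field_simp
    linarith

/-- Gibbs' inequality: `g` is a competitor with the same total mass as `f`. -/
lemma sum_mul_log_le {p f g : Ω → ℝ} (hp : ∀ x, 0 ≤ p x) (hf : ∀ x, 0 ≤ f x) (hg : ∀ x, 0 < g x)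
    (h : ∑ x, p x * g x ≤ ∑ x, p x * f x) :
    ∑ x, p x * (f x * Real.log (g x)) ≤ ∑ x, p x * (f x * Real.log (f x)) := by
  have : ∑ x, p x * (f x - g x) ≤ ∑ x, p x * (f x * Real.log (f x) - f x * Real.log (g x)) :=
    Finset.sum_le_sum fun x _ =>
      mul_le_mul_of_nonneg_left (sub_le_mul_log_sub (hf x) (hg x)) (hp x)
  simp only [mul_sub, Finset.sum_sub_distrib] at this
  linarith

lemma wEnt_smul (c : ℝ) (p f : Ω → ℝ) : wEnt (fun x => c * p x) f = c * wEnt p f := by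
  rcases eq_or_ne c 0 with rfl | hc
  · simp [wEnt]
  · simp only [wEnt, mul_assoc, ← Finset.mul_sum]
    rw [mul_div_mul_left _ _ hc]
    ring

lemma wEnt_nonneg {p f : Ω → ℝ} (hp : ∀ x, 0 ≤ p x) (hf : ∀ x, 0 ≤ f x) : 0 ≤ wEnt p f := by
  have h0 : 0 ≤ ∑ x, p x * f x := Finset.sum_nonneg fun x _ => mul_nonneg (hp x) (hf x)
  have h1 : 0 ≤ ∑ x, p x := Finset.sum_nonneg fun x _ => hp x
  rcases h0.eq_or_lt with h | h
  · have hz : ∀ x, p x * f x = 0 := fun x =>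
      (Finset.sum_eq_zero_iff_of_nonneg fun x _ => mul_nonneg (hp x) (hf x)).1 h.symm x
        (Finset.mem_univ x)
    simp [wEnt, ← mul_assoc, hz]
  · have h2 : 0 < ∑ x, p x := by
      refine h1.lt_of_ne fun hz => h.ne ?_
      have := (Finset.sum_eq_zero_iff_of_nonneg fun x _ => hp x).1 hz.symm
      exact (Finset.sum_eq_zero fun x hx => by rw [this x hx, zero_mul]).symm
    have := sum_mul_log_le (g := fun _ => (∑ x, p x * f x) / ∑ x, p x) hp hf
      (fun _ => div_pos h h2) (by rw [← Finset.sum_mul, mul_div_cancel₀ _ h2.ne'])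
    simp only [← mul_assoc, ← Finset.sum_mul] at this
    simp only [wEnt, ← mul_assoc]
    linarith

/-- Continuity persists where f vanishes because t log t does so; this later extends inequalities
from positive f to nonnegative f. -/
lemma continuous_wEnt (p : Ω → ℝ) : Continuous fun f : Ω → ℝ => wEnt p f := by
  have key : ∀ Z : ℝ, Continuous fun t : ℝ => t * Real.log (t / Z) := by
    intro Z
    rcases eq_or_ne Z 0 with rfl | hZ
    · simpa using continuous_const
    · have : (fun t : ℝ => t * Real.log (t / Z)) = fun t => Z * (t / Z * Real.log (t / Z)) := by
        funext t
        field_simp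
      rw [this]
      exact continuous_const.mul (Real.continuous_mul_log.comp (continuous_id.div_const Z))
  unfold wEnt
  refine Continuous.sub ?_ ?_
  · exact continuous_finsetSum _ fun x _ =>
      continuous_const.mul (Real.continuous_mul_log.comp (continuous_apply x))
  · exact (key _).comp (continuous_finsetSum _ fun x _ => continuous_const.mul (continuous_apply x))

/-- Subadditivity of entropy for a product of two weights. -/
lemma wEnt_prod_le [Nonempty A] [Nonempty B] {p : A → ℝ} {q : B → ℝ} {f : A → B → ℝ}
    (hp : ∀ a, 0 < p a) (hq : ∀ b, 0 < q b) (hf : ∀ a b, 0 < f a b) :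
    wEnt (fun x : A × B => p x.1 * q x.2) (fun x => f x.1 x.2) ≤
      ∑ b, q b * wEnt p (fun a => f a b) + ∑ a, p a * wEnt q (fun b => f a b) := by
  set P := ∑ a, p a
  set Q := ∑ b, q b
  set F : B → ℝ := fun b => ∑ a, p a * f a b with hF
  set H : A → ℝ := fun a => ∑ b, q b * f a b with hH
  set T := ∑ x : A × B, p x.1 * q x.2 * f x.1 x.2 with hT
  have hP : 0 < P := Finset.sum_pos (fun a _ => hp a) Finset.univ_nonempty
  have hQ : 0 < Q := Finset.sum_pos (fun a _ => hq a) Finset.univ_nonempty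
  have hF0 : ∀ b, 0 < F b := fun b =>
    Finset.sum_pos (fun a _ => mul_pos (hp a) (hf a b)) Finset.univ_nonempty
  have hH0 : ∀ a, 0 < H a := fun a =>
    Finset.sum_pos (fun b _ => mul_pos (hq b) (hf a b)) Finset.univ_nonempty
  have hT0 : 0 < T := Finset.sum_pos
    (fun x _ => mul_pos (mul_pos (hp _) (hq _)) (hf _ _)) Finset.univ_nonempty
  have hTF : ∑ b, q b * F b = T := by
    rw [hT, Fintype.sum_prod_type_right]
    refine Finset.sum_congr rfl fun b _ => ?_
    rw [hF, Finset.mul_sum]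
    exact Finset.sum_congr rfl fun a _ => by ring
  have hTH : ∑ a, p a * H a = T := by
    rw [hT, Fintype.sum_prod_type]
    refine Finset.sum_congr rfl fun b _ => ?_
    rw [hH, Finset.mul_sum]
    exact Finset.sum_congr rfl fun a _ => by ring
  have hPQ : ∑ x : A × B, p x.1 * q x.2 = P * Q := by
    rw [Fintype.sum_prod_type, Finset.sum_mul_sum]
  -- The competitor is the product of the two marginals, scaled to the mass T of f; its logarithm
  -- splits into the two marginal terms.
  have gibbs := sum_mul_log_le (p := fun x : A × B => p x.1 * q x.2) (f := fun x => f x.1 x.2)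
    (g := fun x => H x.1 * F x.2 / T) (fun x => (mul_pos (hp _) (hq _)).le)
    (fun x => (hf _ _).le) (fun x => div_pos (mul_pos (hH0 _) (hF0 _)) hT0) (by
      apply le_of_eq
      rw [← hT]
      have : ∀ x : A × B, p x.1 * q x.2 * (H x.1 * F x.2 / T) =
          (p x.1 * H x.1) * (q x.2 * F x.2) / T := fun x => by ring
      rw [Finset.sum_congr rfl fun x _ => this x, ← Finset.sum_div, Fintype.sum_prod_type]
      dsimp only
      rw [← Finset.sum_mul_sum, hTF, hTH]
      field_simp)
  have hlog : ∀ x : A × B, p x.1 * q x.2 * (f x.1 x.2 * Real.log (H x.1 * F x.2 / T)) =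
      p x.1 * (q x.2 * f x.1 x.2 * Real.log (H x.1 / Q)) +
      q x.2 * (p x.1 * f x.1 x.2 * Real.log (F x.2 / P)) -
      p x.1 * q x.2 * f x.1 x.2 * Real.log (T / (P * Q)) := fun x => by
    rw [Real.log_div (mul_pos (hH0 _) (hF0 _)).ne' hT0.ne', Real.log_mul (hH0 _).ne' (hF0 _).ne',
      Real.log_div (hH0 _).ne' hQ.ne', Real.log_div (hF0 _).ne' hP.ne',
      Real.log_div hT0.ne' (mul_pos hP hQ).ne', Real.log_mul hP.ne' hQ.ne']
    ring
  rw [Finset.sum_congr rfl fun x _ => hlog x, Finset.sum_sub_distrib, Finset.sum_add_distrib,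
    ← Finset.sum_mul, ← hT] at gibbs
  have e1 : ∑ x : A × B, p x.1 * (q x.2 * f x.1 x.2 * Real.log (H x.1 / Q)) =
      ∑ a, p a * (H a * Real.log (H a / Q)) := by
    rw [Fintype.sum_prod_type]
    refine Finset.sum_congr rfl fun a _ => ?_
    dsimp only
    rw [← Finset.mul_sum, ← Finset.sum_mul]
  have e2 : ∑ x : A × B, q x.2 * (p x.1 * f x.1 x.2 * Real.log (F x.2 / P)) =
      ∑ b, q b * (F b * Real.log (F b / P)) := by
    rw [Fintype.sum_prod_type_right]
    refine Finset.sum_congr rfl fun a _ => ?_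
    dsimp only
    rw [← Finset.mul_sum, ← Finset.sum_mul]
  have e3 : ∑ b, q b * ∑ a, p a * (f a b * Real.log (f a b)) =
      ∑ x : A × B, p x.1 * q x.2 * (f x.1 x.2 * Real.log (f x.1 x.2)) := by
    rw [Fintype.sum_prod_type_right]
    refine Finset.sum_congr rfl fun b _ => ?_
    rw [Finset.mul_sum]
    exact Finset.sum_congr rfl fun a _ => by ring
  have e4 : ∑ a, p a * ∑ b, q b * (f a b * Real.log (f a b)) =
      ∑ x : A × B, p x.1 * q x.2 * (f x.1 x.2 * Real.log (f x.1 x.2)) := by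
    rw [Fintype.sum_prod_type]
    refine Finset.sum_congr rfl fun b _ => ?_
    rw [Finset.mul_sum]
    exact Finset.sum_congr rfl fun a _ => by ring
  simp only [wEnt, mul_sub, Finset.sum_sub_distrib]
  rw [e3, e4, hPQ, ← hT]
  rw [e1, e2] at gibbs
  linarith

lemma wEnt_comp_equiv (e : A ≃ B) (p f : B → ℝ) :
    wEnt (fun a => p (e a)) (fun a => f (e a)) = wEnt p f := by
  simp only [wEnt, e.sum_comp (fun b => p b * (f b * Real.log (f b))),
    e.sum_comp (fun b => p b * f b), e.sum_comp p]

end WeightedEntropy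

/-- Half the total of the entropies of `f` along the edges of the cube in direction `i`. -/
noncomputable def edgeEnt {n : ℕ} (p f : Cube n → ℝ) (i : Fin n) : ℝ :=
  (1 / 2) * ∑ x : Cube n,
    wEnt (fun s => p (Function.update x i s)) (fun s => f (Function.update x i s))

lemma sum_cube_succ {n : ℕ} (F : Cube (n + 1) → ℝ) :
    ∑ x, F x = ∑ s : ℤˣ, ∑ y : Cube n, F (Fin.cons s y) := by
  rw [← Fintype.sum_prod_type' (fun s (y : Cube n) => F (Fin.cons s y)),
    ← (Fin.consEquiv fun _ : Fin (n + 1) => ℤˣ).sum_comp]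
  rfl

/-- Tensorization of entropy for product weights on the cube. -/
lemma wEnt_pi_le : ∀ {n : ℕ} {p : Fin n → ℤˣ → ℝ} {f : Cube n → ℝ},
    (∀ i s, 0 < p i s) → (∀ x, 0 < f x) →
    wEnt (fun x => ∏ i, p i (x i)) f ≤ ∑ i, edgeEnt (fun x => ∏ i, p i (x i)) f i := by
  intro n
  induction n with
  | zero =>
    intro p f _ _
    simp [wEnt]
  | succ n ih =>
    intro p f hp hf
    set q : Cube n → ℝ := fun y => ∏ i : Fin n, p i.succ (y i) with hq
    have hq0 : ∀ y, 0 < q y := fun y => Finset.prod_pos fun i _ => hp _ _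
    have h1 := wEnt_prod_le (p := p 0) (q := q) (f := fun s y => f (Fin.cons s y)) (hp 0) hq0
      (fun s y => hf _)
    have h2 : wEnt (fun x : Cube (n + 1) => ∏ i, p i (x i)) f =
        wEnt (fun x : ℤˣ × Cube n => p 0 x.1 * q x.2) (fun x => f (Fin.cons x.1 x.2)) := by
      rw [← wEnt_comp_equiv (Fin.consEquiv fun _ : Fin (n + 1) => ℤˣ)]
      congr 1
      funext x
      simp [Fin.consEquiv, Fin.prod_univ_succ, hq]
    rw [h2, Fin.sum_univ_succ]
    refine h1.trans (add_le_add (le_of_eq ?_) ?_)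
    -- The edge in direction 0 does not depend on the 0-th coordinate, so it is counted twice,
    -- cancelling the factor 1/2 in `edgeEnt`.
    · rw [edgeEnt, sum_cube_succ]
      simp only [Fin.update_cons_zero, Fin.prod_univ_succ, Fin.cons_zero, Fin.cons_succ]
      have : ∀ y : Cube n, wEnt (fun s => p 0 s * ∏ i : Fin n, p i.succ (y i))
          (fun s => f (Fin.cons s y)) = q y * wEnt (p 0) (fun s => f (Fin.cons s y)) := fun y => by
        rw [← wEnt_smul]
        congr 1
        funext s
        rw [hq, mul_comm]
      simp only [this, Finset.sum_const, Finset.card_univ, Fintype.card_units_int]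
      simp
    · have h3 : ∀ s : ℤˣ, p 0 s * wEnt q (fun y => f (Fin.cons s y)) ≤
          p 0 s * ∑ i, edgeEnt q (fun y => f (Fin.cons s y)) i := fun s =>
        mul_le_mul_of_nonneg_left (ih (fun i s => hp _ s) fun y => hf _) (hp 0 s).le
      refine (Finset.sum_le_sum fun s _ => h3 s).trans (le_of_eq ?_)
      simp only [Finset.mul_sum]
      rw [Finset.sum_comm]
      refine Finset.sum_congr rfl fun i _ => ?_
      rw [edgeEnt, sum_cube_succ, Finset.mul_sum]
      refine Finset.sum_congr rfl fun s _ => ?_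
      rw [edgeEnt, mul_left_comm, Finset.mul_sum]
      congr 1
      refine Finset.sum_congr rfl fun y _ => ?_
      rw [← wEnt_smul]
      simp only [← Fin.cons_update, Fin.prod_univ_succ, Fin.cons_zero, Fin.cons_succ, hq]

/-! ### A maximum principle for parabolic inequalities on a strip -/

/-- `Gt`, `G1` and `G2` are the time derivative and the first two space derivatives of `G`. -/
structure ParabolicDerivs (G Gt G1 G2 : ℝ → ℝ → ℝ) : Prop where
  time : ∀ τ θ, HasDerivAt (fun t => G t θ) (Gt τ θ) τ
  space : ∀ τ θ, HasDerivAt (fun y => G τ y) (G1 τ θ) θ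
  space₂ : ∀ τ θ, HasDerivAt (fun y => G1 τ y) (G2 τ θ) θ

/-- A negative second derivative would make x a local maximum too, so F would be locally constant
and its second derivative zero. -/
lemma second_deriv_nonneg_of_isLocalMin {F F' : ℝ → ℝ} {c x : ℝ}
    (h1 : ∀ y, HasDerivAt F (F' y) y) (h2 : HasDerivAt F' c x) (hmin : IsLocalMin F x) :
    0 ≤ c := by
  by_contra! hc
  have hd : deriv F = F' := funext fun y => (h1 y).deriv
  have hdd : deriv (deriv F) x = c := by rw [hd, h2.deriv]
  have hmax := isLocalMax_of_deriv_deriv_neg (hdd ▸ hc) hmin.deriv_eq_zero (h1 x).continuousAt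
  have hconst : F =ᶠ[nhds x] fun _ => F x := by
    filter_upwards [hmin, hmax] with y hy hy' using le_antisymm hy' hy
  have h0 : deriv (deriv F) x = 0 := by
    rw [hconst.deriv.deriv_eq]
    simp
  exact hc.ne (hdd ▸ h0)

/-- Only times before x are compared, since the space-time minimum may sit on the final time slice.
-/
lemma deriv_nonpos_of_forall_le {F : ℝ → ℝ} {c a x : ℝ} (h : HasDerivAt F c x) (hax : a < x)
    (hmin : ∀ y ∈ Set.Icc a x, F x ≤ F y) : c ≤ 0 := by
  have h1 := (hasDerivAt_iff_tendsto_slope.1 h).mono_left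
    (nhdsWithin_mono x (fun y (hy : y < x) => hy.ne) : nhdsWithin x (Set.Iio x) ≤ _)
  refine le_of_tendsto h1 ?_
  filter_upwards [Ioo_mem_nhdsLT hax] with y hy
  rw [slope_def_field]
  exact div_nonpos_of_nonneg_of_nonpos (sub_nonneg.2 (hmin y ⟨hy.1.le, hy.2.le⟩))
    (sub_nonpos.2 hy.2.le)

/-- The strip is unbounded, so a small barrier ε exp(L t) cosh(N y), growing faster than the allowed
negative part of G, is added to trap a negative minimum in a compact rectangle. It is attained at t
> 0 and at an interior y, where the first- and second-order conditions contradict the differential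
inequality. -/
theorem parabolic_max_principle {G Gt G1 G2 b c : ℝ → ℝ → ℝ} {A B M : ℝ}
    (hcont : Continuous (Function.uncurry G)) (hG : ParabolicDerivs G Gt G1 G2)
    (hb : ∀ τ θ, |b τ θ| ≤ B) (hc : ∀ τ θ, |c τ θ| ≤ B)
    (hineq : ∀ τ ∈ Set.Icc (0 : ℝ) 1, ∀ θ,
      (1 / 2) * G2 τ θ + b τ θ * G1 τ θ + c τ θ * G τ θ ≤ Gt τ θ)
    (hgrow : ∀ τ ∈ Set.Icc (0 : ℝ) 1, ∀ θ, -(A * Real.exp (M * |θ|)) ≤ G τ θ)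
    (h0 : ∀ θ, 0 ≤ G 0 θ) {τ : ℝ} (hτ : τ ∈ Set.Icc (0 : ℝ) 1) (θ : ℝ) : 0 ≤ G τ θ := by
  by_contra! hneg
  have hB : 0 ≤ B := (abs_nonneg _).trans (hb 0 0)
  -- N beats the growth rate M. The terms of L absorb ½ ∂²φ, b ∂φ and c φ in turn, and the final 1
  -- leaves a strict margin.
  set N := |M| + 1
  have hN : 0 < N := by positivity
  set L := N ^ 2 / 2 + B * N + B + 1
  set φ : ℝ → ℝ → ℝ := fun t y => Real.exp (L * t) * Real.cosh (N * y) with hφ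
  have hφ0 : ∀ t y, 0 < φ t y := fun t y => mul_pos (Real.exp_pos _) (Real.cosh_pos _)
  -- With this ε the perturbed function H equals G τ θ / 2 at (τ, θ), hence is still negative there.
  set ε := -G τ θ / (2 * φ τ θ) with hε
  have hε0 : 0 < ε := div_pos (neg_pos.2 hneg) (mul_pos two_pos (hφ0 _ _))
  set H : ℝ → ℝ → ℝ := fun t y => G t y + ε * φ t y with hH
  have hH0 : H τ θ < 0 := by
    have : ε * φ τ θ = -G τ θ / 2 := by
      rw [hε]
      field_simp [(hφ0 τ θ).ne']
    simp only [hH, this]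
    linarith
  set R := max |θ| (2 * |A| / ε)
  have hfar : ∀ t ∈ Set.Icc (0 : ℝ) 1, ∀ y, R ≤ |y| → 0 ≤ H t y := by
    intro t ht y hy
    have h1 := hgrow t ht y
    have h2 : Real.exp (N * |y|) / 2 ≤ φ t y := by
      have e1 : (1 : ℝ) ≤ Real.exp (L * t) := Real.one_le_exp (mul_nonneg (by positivity) ht.1)
      have e2 : Real.exp (N * |y|) / 2 ≤ Real.cosh (N * y) := by
        rw [← Real.cosh_abs, abs_mul, abs_of_pos hN, Real.cosh_eq]
        have := Real.exp_pos (-(N * |y|))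
        linarith
      calc _ ≤ Real.cosh (N * y) := e2
        _ = 1 * Real.cosh (N * y) := (one_mul _).symm
        _ ≤ _ := mul_le_mul_of_nonneg_right e1 (Real.cosh_pos _).le
    have h3 : |A| * Real.exp (|M| * |y|) ≤ ε * (Real.exp (N * |y|) / 2) := by
      have : Real.exp (N * |y|) = Real.exp |y| * Real.exp (|M| * |y|) := by
        rw [← Real.exp_add]
        congr 1
        ring
      rw [this]
      have h4 : 2 * |A| / ε ≤ Real.exp |y| :=
        ((le_max_right _ _).trans hy).trans
          ((by linarith : |y| ≤ |y| + 1).trans (Real.add_one_le_exp _))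
      rw [div_le_iff₀ hε0] at h4
      have := mul_le_mul_of_nonneg_right h4 (Real.exp_pos (|M| * |y|)).le
      linarith
    have h5 : A * Real.exp (M * |y|) ≤ |A| * Real.exp (|M| * |y|) :=
      mul_le_mul (le_abs_self A) (Real.exp_le_exp.2
        (mul_le_mul_of_nonneg_right (le_abs_self M) (abs_nonneg y))) (Real.exp_pos _).le
        (abs_nonneg A)
    have h6 := mul_le_mul_of_nonneg_left h2 hε0.le
    simp only [hH]
    linarith
  -- The factor exp(-B t) handles c of either sign: at a negative minimum of Q, ∂_t H ≤ B H ≤ c H.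
  set Q : ℝ × ℝ → ℝ := fun z => Real.exp (-B * z.1) * H z.1 z.2 with hQ
  have hQc : Continuous Q := by
    have e : Q = fun z => Real.exp (-B * z.1) * (Function.uncurry G z +
      ε * (Real.exp (L * z.1) * Real.cosh (N * z.2))) := by
      funext z
      simp [hQ, hH, hφ, Function.uncurry]
    rw [e]
    fun_prop
  obtain ⟨⟨t, y⟩, ⟨ht, hy⟩, hmin⟩ := (isCompact_Icc (a := (0 : ℝ)) (b := 1)).prod
    (isCompact_Icc (a := -R) (b := R)) |>.exists_isMinOn
      ⟨(τ, θ), hτ, abs_le.1 (le_max_left _ _)⟩ hQc.continuousOn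
  have hQt : Q (t, y) < 0 := lt_of_le_of_lt
    (hmin (⟨hτ, abs_le.1 (le_max_left _ _)⟩ : (τ, θ) ∈ Set.Icc (0 : ℝ) 1 ×ˢ Set.Icc (-R) R))
    (mul_neg_of_pos_of_neg (Real.exp_pos _) hH0)
  have hHt : H t y < 0 := by
    by_contra! hh
    exact absurd hQt (not_lt.2 (mul_nonneg (Real.exp_pos _).le hh))
  have ht0 : 0 < t := by
    refine ht.1.lt_of_ne fun h => absurd hHt (not_lt.2 ?_)
    subst h
    exact add_nonneg (h0 y) (mul_pos hε0 (hφ0 _ _)).le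
  have hyR : |y| < R := by
    by_contra! hh
    exact absurd hHt (not_lt.2 (hfar t ht y hh))
  have hφ1 : ∀ y, HasDerivAt (fun y => φ t y) (Real.exp (L * t) * (N * Real.sinh (N * y))) y := by
    intro y
    have := ((hasDerivAt_id y).const_mul N).cosh.const_mul (Real.exp (L * t))
    refine this.congr_deriv ?_
    simp only [id]
    ring
  have hφ2 : HasDerivAt (fun y => Real.exp (L * t) * (N * Real.sinh (N * y)))
      (N ^ 2 * φ t y) y := by
    have := (((hasDerivAt_id y).const_mul N).sinh.const_mul N).const_mul (Real.exp (L * t))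
    refine this.congr_deriv ?_
    simp only [id, hφ]
    ring
  have hφt : HasDerivAt (fun t => φ t y) (L * φ t y) t := by
    have := ((hasDerivAt_id t).const_mul L).exp.mul_const (Real.cosh (N * y))
    refine this.congr_deriv ?_
    simp only [id, hφ]
    ring
  have d1 : ∀ y, HasDerivAt (fun y => H t y)
      (G1 t y + ε * (Real.exp (L * t) * (N * Real.sinh (N * y)))) y := fun y =>
    (hG.space t y).add ((hφ1 y).const_mul ε)
  have d2 := (hG.space₂ t y).add (hφ2.const_mul ε)
  have dt := (hG.time t y).add (hφt.const_mul ε)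
  have hlocal : IsLocalMin (fun y => H t y) y := by
    filter_upwards [Ioo_mem_nhds (abs_lt.1 hyR).1 (abs_lt.1 hyR).2] with z hz
    have := hmin (⟨ht, hz.1.le, hz.2.le⟩ : (t, z) ∈ Set.Icc (0 : ℝ) 1 ×ˢ Set.Icc (-R) R)
    exact le_of_mul_le_mul_left this (Real.exp_pos _)
  have s1 := hlocal.hasDerivAt_eq_zero (d1 y)
  have s2 := second_deriv_nonneg_of_isLocalMin d1 d2 hlocal
  have s3 := deriv_nonpos_of_forall_le
    ((((hasDerivAt_id t).const_mul (-B)).exp.mul dt)) ht0 (fun z hz => by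
      exact hmin (⟨⟨hz.1, hz.2.trans ht.2⟩, hy⟩ :
        (z, y) ∈ Set.Icc (0 : ℝ) 1 ×ˢ Set.Icc (-R) R))
  have s4 : Gt t y + ε * (L * φ t y) ≤ B * H t y := by
    have hE := Real.exp_pos (-B * t)
    have e : Real.exp (-B * t) * (Gt t y + ε * (L * φ t y) - B * H t y) ≤ 0 := by
      refine le_trans (le_of_eq ?_) s3
      simp only [hH, id, Pi.add_apply]
      ring
    have := nonpos_of_mul_nonpos_right e hE
    linarith
  have s5 := hineq t ht y
  have s6 : |b t y * (Real.exp (L * t) * (N * Real.sinh (N * y)))| ≤ B * N * φ t y := by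
    have hs : |Real.sinh (N * y)| ≤ Real.cosh (N * y) :=
      abs_le.2 ⟨by linarith [Real.cosh_add_sinh (N * y), Real.exp_pos (N * y)],
        (Real.sinh_lt_cosh _).le⟩
    rw [abs_mul, abs_mul, abs_mul, abs_of_pos hN, abs_of_pos (Real.exp_pos _)]
    calc |b t y| * (Real.exp (L * t) * (N * |Real.sinh (N * y)|))
        ≤ B * (Real.exp (L * t) * (N * Real.cosh (N * y))) := by
          gcongr
          exact hb t y
      _ = _ := by
          simp only [hφ]
          ring
  have s7 : c t y * φ t y ≤ B * φ t y :=
    mul_le_mul_of_nonneg_right ((le_abs_self _).trans (hc t y)) (hφ0 t y).le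
  have s8 : B * H t y ≤ c t y * H t y :=
    mul_le_mul_of_nonpos_right ((le_abs_self _).trans (hc t y)) hHt.le
  have hφt0 := mul_pos hε0 (hφ0 t y)
  set ψ := Real.exp (L * t) * (N * Real.sinh (N * y))
  have s9 : b t y * G1 t y = -(ε * (b t y * ψ)) := by
    have : G1 t y = -(ε * ψ) := by linarith
    rw [this]
    ring
  have s10 := mul_le_mul_of_nonneg_left ((le_abs_self _).trans s6) hε0.le
  have s11 := mul_le_mul_of_nonneg_left s7 hε0.le
  have s12 : c t y * G t y = c t y * H t y - ε * (c t y * φ t y) := by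
    simp only [hH]
    ring
  have s13 : ε * (L * φ t y) = ε * (N ^ 2 * φ t y) / 2 + ε * (B * N * φ t y) + ε * (B * φ t y) +
      ε * φ t y := by ring
  linarith

section HeatFlow

variable {Ω : Type*} [Fintype Ω]

/-! ### Exponential families solving the heat equation -/

/-- The `k`-th moment of `a` under the weight `q` tilted by `exp (τ a² / 2 + θ a)`. -/
noncomputable def heat (a q : Ω → ℝ) (k : ℕ) (τ θ : ℝ) : ℝ :=
  ∑ x, q x * a x ^ k * Real.exp (τ * (a x ^ 2 / 2) + θ * a x)

lemma hasDerivAt_heat_space (a q : Ω → ℝ) (k : ℕ) (τ θ : ℝ) :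
    HasDerivAt (fun y => heat a q k τ y) (heat a q (k + 1) τ θ) θ := by
  refine (HasDerivAt.fun_sum fun x _ => (((hasDerivAt_id θ).mul_const (a x)).const_add
    (τ * (a x ^ 2 / 2))).exp.const_mul (q x * a x ^ k)).congr_deriv ?_
  exact Finset.sum_congr rfl fun x _ => by simp only [id]; ring

/-- A time derivative brings down a²/2, half of what two space derivatives bring down: `heat` solves
∂_τ = ½ ∂_θ². -/
lemma hasDerivAt_heat_time (a q : Ω → ℝ) (k : ℕ) (τ θ : ℝ) :
    HasDerivAt (fun t => heat a q k t θ) (heat a q (k + 2) τ θ / 2) τ := by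
  refine (HasDerivAt.fun_sum fun x _ => (((hasDerivAt_id τ).mul_const (a x ^ 2 / 2)).add_const
    (θ * a x)).exp.const_mul (q x * a x ^ k)).congr_deriv ?_
  rw [heat, Finset.sum_div]
  exact Finset.sum_congr rfl fun x _ => by simp only [id]; ring

lemma continuous_heat (a q : Ω → ℝ) (k : ℕ) :
    Continuous fun z : ℝ × ℝ => heat a q k z.1 z.2 := by
  unfold heat
  fun_prop

lemma heat_pos {a q : Ω → ℝ} (hq : ∀ x, 0 ≤ q x) (hq' : ∃ x, 0 < q x) (τ θ : ℝ) :
    0 < heat a q 0 τ θ := by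
  obtain ⟨x, hx⟩ := hq'
  refine Finset.sum_pos' (fun x _ => ?_) ⟨x, Finset.mem_univ x, ?_⟩
  · have := hq x
    positivity
  · positivity

lemma abs_heat_le {a q : Ω → ℝ} {R : ℝ} (hq : ∀ x, 0 ≤ q x) (ha : ∀ x, |a x| ≤ R) (k : ℕ)
    (τ θ : ℝ) : |heat a q k τ θ| ≤ R ^ k * heat a q 0 τ θ := by
  rw [heat, heat, Finset.mul_sum]
  refine (Finset.abs_sum_le_sum_abs _ _).trans (Finset.sum_le_sum fun x _ => ?_)
  rw [abs_mul, abs_mul, abs_pow, abs_of_nonneg (hq x), abs_of_pos (Real.exp_pos _)]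
  have h1 := pow_le_pow_left₀ (abs_nonneg _) (ha x) k
  have h2 := mul_le_mul_of_nonneg_left h1
    (mul_nonneg (hq x) (Real.exp_pos (τ * (a x ^ 2 / 2) + θ * a x)).le)
  nlinarith [h2]

lemma heat_le_exp {a q : Ω → ℝ} {R : ℝ} (hR : ∀ x, |a x| ≤ R) {τ : ℝ}
    (hτ : τ ∈ Set.Icc (0 : ℝ) 1) (θ : ℝ) :
    heat a q 0 τ θ ≤ (∑ x, |q x|) * Real.exp (R ^ 2 / 2) * Real.exp (R * |θ|) := by
  rw [heat, Finset.sum_mul, Finset.sum_mul]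
  refine Finset.sum_le_sum fun x _ => ?_
  have h1 : τ * (a x ^ 2 / 2) + θ * a x ≤ R ^ 2 / 2 + R * |θ| := by
    have e1 : a x ^ 2 ≤ R ^ 2 := sq_le_sq' (abs_le.1 (hR x)).1 (abs_le.1 (hR x)).2
    have e2 : τ * (a x ^ 2 / 2) ≤ 1 * (a x ^ 2 / 2) :=
      mul_le_mul_of_nonneg_right hτ.2 (by positivity)
    have e3 : θ * a x ≤ |θ| * R := (le_abs_self _).trans (by
      rw [abs_mul]
      exact mul_le_mul_of_nonneg_left (hR x) (abs_nonneg θ))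
    linarith
  rw [mul_assoc |q x|, ← Real.exp_add, pow_zero, mul_one]
  exact mul_le_mul (le_abs_self _) (Real.exp_le_exp.2 h1) (Real.exp_pos _).le (abs_nonneg _)

/-! ### The variance bound -/

/-- The normalized moments of `a`. -/
noncomputable def moment (a p : Ω → ℝ) (k : ℕ) (τ θ : ℝ) : ℝ :=
  heat a p k τ θ / heat a p 0 τ θ

variable {a p q f : Ω → ℝ}

lemma hasDerivAt_moment_space [Nonempty Ω] (hp : ∀ x, 0 < p x) (k : ℕ) (τ θ : ℝ) :
    HasDerivAt (fun y => moment a p k τ y)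
      (moment a p (k + 1) τ θ - moment a p k τ θ * moment a p 1 τ θ) θ := by
  have h := (heat_pos (a := a) (fun x => (hp x).le) ⟨Classical.arbitrary Ω, hp _⟩ τ θ).ne'
  refine ((hasDerivAt_heat_space a p k τ θ).div (hasDerivAt_heat_space a p 0 τ θ) h).congr_deriv ?_
  simp only [moment]
  field_simp

lemma hasDerivAt_moment_time [Nonempty Ω] (hp : ∀ x, 0 < p x) (k : ℕ) (τ θ : ℝ) :
    HasDerivAt (fun t => moment a p k t θ)
      ((moment a p (k + 2) τ θ - moment a p k τ θ * moment a p 2 τ θ) / 2) τ := by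
  have h := (heat_pos (a := a) (fun x => (hp x).le) ⟨Classical.arbitrary Ω, hp _⟩ τ θ).ne'
  refine ((hasDerivAt_heat_time a p k τ θ).div (hasDerivAt_heat_time a p 0 τ θ) h).congr_deriv ?_
  simp only [moment]
  field_simp

lemma continuous_moment [Nonempty Ω] (hp : ∀ x, 0 < p x) (k : ℕ) :
    Continuous fun z : ℝ × ℝ => moment a p k z.1 z.2 :=
  (continuous_heat a p k).div (continuous_heat a p 0) fun _ =>
    (heat_pos (fun x => (hp x).le) ⟨Classical.arbitrary Ω, hp _⟩ _ _).ne'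

lemma abs_moment_le [Nonempty Ω] (hp : ∀ x, 0 < p x) {R : ℝ} (ha : ∀ x, |a x| ≤ R) (k : ℕ)
    (τ θ : ℝ) : |moment a p k τ θ| ≤ R ^ k := by
  have h := heat_pos (a := a) (fun x => (hp x).le) ⟨Classical.arbitrary Ω, hp _⟩ τ θ
  rw [moment, abs_div, abs_of_pos h, div_le_iff₀ h]
  exact abs_heat_le (fun x => (hp x).le) ha k τ θ

lemma exists_abs_le (a : Ω → ℝ) : ∃ R, ∀ x, |a x| ≤ R :=
  ⟨∑ x, |a x|, fun x =>
    Finset.single_le_sum (f := fun x => |a x|) (fun _ _ => abs_nonneg _) (Finset.mem_univ x)⟩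

/-- The variance of `a` along the flow is at most the solution `s / (1 - τ s)` of `y' = y²`. -/
lemma variance_flow_le [Nonempty Ω] (hp : ∀ x, 0 < p x) {s : ℝ}
    (hvar : ∀ θ, moment a p 2 0 θ - moment a p 1 0 θ ^ 2 ≤ s) {τ : ℝ}
    (hτ : τ ∈ Set.Icc (0 : ℝ) 1) (θ : ℝ) :
    (1 - τ * s) * (moment a p 2 τ θ - moment a p 1 τ θ ^ 2) ≤ s := by
  obtain ⟨R, hR⟩ := exists_abs_le a
  set m := moment a p with hm
  have hm1 : ∀ t y, |m 1 t y| ≤ R := fun t y => by simpa using abs_moment_le hp hR 1 t y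
  have hV : ∀ t y, |m 2 t y - m 1 t y ^ 2| ≤ 2 * R ^ 2 := fun t y => by
    have h1 := abs_moment_le hp hR 2 t y
    have h2 := pow_le_pow_left₀ (abs_nonneg _) (hm1 t y) 2
    have h3 := abs_sub (m 2 t y) (m 1 t y ^ 2)
    rw [abs_pow] at h3
    linarith
  -- Since V solves ∂_τ V = ½ V'' + m₁ V' + V², the function s - (1 - τ s) V solves a linear
  -- equation exactly, with drift m₁ and potential V. All quantities are bounded, so M = 0 suffices.
  have main := parabolic_max_principle
    (G := fun t y => s - (1 - t * s) * (m 2 t y - m 1 t y ^ 2))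
    (Gt := fun t y => s * (m 2 t y - m 1 t y ^ 2) - (1 - t * s) *
      ((m 4 t y - m 2 t y * m 2 t y) / 2 - m 1 t y * (m 3 t y - m 1 t y * m 2 t y)))
    (G1 := fun t y => -((1 - t * s) * (m 3 t y - 3 * (m 1 t y * m 2 t y) + 2 * m 1 t y ^ 3)))
    (G2 := fun t y => -((1 - t * s) * ((m 4 t y - m 3 t y * m 1 t y) -
      3 * ((m 2 t y - m 1 t y * m 1 t y) * m 2 t y + m 1 t y * (m 3 t y - m 2 t y * m 1 t y)) +
      6 * m 1 t y ^ 2 * (m 2 t y - m 1 t y * m 1 t y))))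
    (b := fun t y => m 1 t y) (c := fun t y => m 2 t y - m 1 t y ^ 2)
    (A := |s| + (1 + |s|) * (2 * R ^ 2)) (B := R + 2 * R ^ 2) (M := 0)
    ?_ ⟨fun t y => ?_, fun t y => ?_, fun t y => ?_⟩ (fun t y => ?_) (fun t y => ?_)
    (fun t _ y => le_of_eq ?_) (fun t ht y => ?_) (fun y => ?_) hτ θ
  · linarith
  · have h1 := continuous_moment (a := a) hp 1
    have h2 := continuous_moment (a := a) hp 2
    simp only [Function.uncurry_def, hm]
    fun_prop
  · have e1 := hasDerivAt_moment_time (a := a) hp 1 t y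
    have e2 := hasDerivAt_moment_time (a := a) hp 2 t y
    refine (((((hasDerivAt_id t).mul_const s).const_sub 1).mul
      (e2.sub (e1.pow 2))).const_sub s).congr_deriv ?_
    simp only [id, hm, Pi.sub_apply, Pi.pow_apply]
    norm_num [-mul_eq_mul_left_iff]
    ring
  · have e1 := hasDerivAt_moment_space (a := a) hp 1 t y
    have e2 := hasDerivAt_moment_space (a := a) hp 2 t y
    refine (((e2.sub (e1.pow 2)).const_mul (1 - t * s)).const_sub s).congr_deriv ?_
    simp only [hm]
    norm_num [-mul_eq_mul_left_iff]
    ring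
  · have e1 := hasDerivAt_moment_space (a := a) hp 1 t y
    have e2 := hasDerivAt_moment_space (a := a) hp 2 t y
    have e3 := hasDerivAt_moment_space (a := a) hp 3 t y
    refine ((((e3.sub ((e1.mul e2).const_mul 3)).add
      ((e1.pow 3).const_mul 2)).const_mul (1 - t * s)).neg).congr_deriv ?_
    simp only [hm]
    norm_num [-mul_eq_mul_left_iff]
    ring
  · linarith [hm1 t y, sq_nonneg R]
  · linarith [hV t y, (abs_nonneg _).trans (hm1 t y)]
  · ring
  · have h1 : |1 - t * s| ≤ 1 + |s| := by
      refine (abs_sub _ _).trans ?_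
      rw [abs_one, abs_mul, abs_of_nonneg ht.1]
      linarith [mul_le_mul_of_nonneg_right ht.2 (abs_nonneg s)]
    have h2 : |(1 - t * s) * (m 2 t y - m 1 t y ^ 2)| ≤ (1 + |s|) * (2 * R ^ 2) := by
      rw [abs_mul]
      exact mul_le_mul h1 (hV t y) (abs_nonneg _) (by positivity)
    simp only [zero_mul, Real.exp_zero, mul_one]
    linarith [neg_abs_le s, le_abs_self ((1 - t * s) * (m 2 t y - m 1 t y ^ 2))]
  · have := hvar y
    simp only [zero_mul, sub_zero, one_mul]
    linarith

lemma tangent_le {g g' g'' : ℝ → ℝ} (h1 : ∀ y, HasDerivAt g (g' y) y)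
    (h2 : ∀ y, HasDerivAt g' (g'' y) y) (h3 : ∀ y, 0 ≤ g'' y) (x t : ℝ) :
    g x + t * g' x ≤ g (x + t) := by
  have hmono : Monotone g' := monotone_of_hasDerivAt_nonneg h2 h3
  have hc : Continuous g := continuous_iff_continuousAt.2 fun y => (h1 y).continuousAt
  rcases lt_trichotomy t 0 with ht | rfl | ht
  · obtain ⟨c, hc, h⟩ := exists_hasDerivAt_eq_slope g g' (by linarith : x + t < x)
      hc.continuousOn fun y _ => h1 y
    have := hmono hc.2.le
    rw [h, div_le_iff₀ (by linarith)] at this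
    linarith
  · simp
  · obtain ⟨c, hc, h⟩ := exists_hasDerivAt_eq_slope g g' (by linarith : x < x + t)
      hc.continuousOn fun y _ => h1 y
    have := hmono hc.1.le
    rw [h, le_div_iff₀ (by linarith)] at this
    linarith

/-- The second θ-derivative of the log-partition function is the variance of a, so K θ²/2 minus it
is convex and lies above its tangents. This is a sub-Gaussian bound on the exponential moments of a.
-/
lemma log_heat_add_le [Nonempty Ω] (hp : ∀ x, 0 < p x) {K τ : ℝ}
    (hK : ∀ θ, moment a p 2 τ θ - moment a p 1 τ θ ^ 2 ≤ K) (θ t : ℝ) :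
    Real.log (heat a p 0 τ (θ + t)) ≤
      Real.log (heat a p 0 τ θ) + t * moment a p 1 τ θ + K * t ^ 2 / 2 := by
  have h := fun y => (heat_pos (a := a) (fun x => (hp x).le) ⟨Classical.arbitrary Ω, hp _⟩ τ y).ne'
  have := tangent_le (g := fun y => K * y ^ 2 / 2 - Real.log (heat a p 0 τ y))
    (g' := fun y => K * y - moment a p 1 τ y)
    (g'' := fun y => K - (moment a p 2 τ y - moment a p 1 τ y * moment a p 1 τ y))
    (fun y => ((((hasDerivAt_id y).pow 2).const_mul K).div_const 2 |>.sub
      ((hasDerivAt_heat_space a p 0 τ y).log (h y))).congr_deriv (by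
        simp only [id, moment]
        norm_num
        ring))
    (fun y => (((hasDerivAt_id y).const_mul K).sub
      (hasDerivAt_moment_space hp 1 τ y)).congr_deriv (by simp))
    (fun y => by nlinarith [hK y]) θ t
  nlinarith [this]

/-! ### Entropy along the flow -/

/-- The entropy of `f` with respect to the tilted weight. -/
noncomputable def entFlow (a q f : Ω → ℝ) (τ θ : ℝ) : ℝ :=
  wEnt (fun x => q x * Real.exp (τ * (a x ^ 2 / 2) + θ * a x)) f

lemma entFlow_eq (a q f : Ω → ℝ) (τ θ : ℝ) :
    entFlow a q f τ θ = heat a (fun x => q x * (f x * Real.log (f x))) 0 τ θ -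
      heat a (fun x => q x * f x) 0 τ θ *
        Real.log (heat a (fun x => q x * f x) 0 τ θ / heat a q 0 τ θ) := by
  simp only [entFlow, wEnt, heat, pow_zero, mul_one]
  simp only [mul_right_comm]

lemma entFlow_nonneg (hq : ∀ x, 0 ≤ q x) (hf : ∀ x, 0 ≤ f x) (τ θ : ℝ) :
    0 ≤ entFlow a q f τ θ :=
  wEnt_nonneg (fun x => mul_nonneg (hq x) (Real.exp_pos _).le) hf

/-- A variance bound for the tilted measures bounds the displacement of the mean of `a` by the
entropy. -/
lemma sq_mean_shift_le [Nonempty Ω] (hp : ∀ x, 0 < p x) (hf : ∀ x, 0 < f x) {K τ : ℝ}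
    (hK : ∀ θ, moment a p 2 τ θ - moment a p 1 τ θ ^ 2 ≤ K) (θ : ℝ) :
    (heat a (fun x => p x * f x) 1 τ θ -
        heat a (fun x => p x * f x) 0 τ θ * moment a p 1 τ θ) ^ 2 ≤
      2 * K * heat a (fun x => p x * f x) 0 τ θ * entFlow a p f τ θ := by
  have hpf : ∀ x, 0 < p x * f x := fun x => mul_pos (hp x) (hf x)
  have hZ := fun y => heat_pos (a := a) (fun x => (hp x).le) ⟨Classical.arbitrary Ω, hp _⟩ τ y
  have hW := heat_pos (a := a) (fun x => (hpf x).le) ⟨Classical.arbitrary Ω, hpf _⟩ τ θ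
  set W := heat a (fun x => p x * f x) 0 τ θ with hWdef
  set W1 := heat a (fun x => p x * f x) 1 τ θ with hW1def
  set w := fun x => p x * Real.exp (τ * (a x ^ 2 / 2) + θ * a x) with hw
  have hw0 : ∀ x, 0 ≤ w x := fun x => (mul_pos (hp x) (Real.exp_pos _)).le
  have eW : ∑ x, w x * f x = W :=
    Finset.sum_congr rfl fun x _ => by simp only [hw, pow_zero]; ring
  have eW1 : ∑ x, w x * f x * a x = W1 :=
    Finset.sum_congr rfl fun x _ => by simp only [hw, pow_one]; ring
  have eZ : ∑ x, w x = heat a p 0 τ θ :=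
    Finset.sum_congr rfl fun x _ => by simp only [hw, pow_zero]; ring
  have eE : entFlow a p f τ θ =
      ∑ x, w x * (f x * Real.log (f x)) - W * Real.log (W / heat a p 0 τ θ) := by
    rw [entFlow, wEnt, eW, eZ]
  -- Gibbs' inequality with the exponential tilt exp(t a) as competitor, combined with the
  -- sub-Gaussian bound, makes this quadratic in t nonnegative; its discriminant gives the claim.
  have key : ∀ t : ℝ, 0 ≤ W * K / 2 * (t * t) + -(W1 - W * moment a p 1 τ θ) * t +
      entFlow a p f τ θ := by
    intro t
    have eZt : ∑ x, w x * Real.exp (t * a x) = heat a p 0 τ (θ + t) :=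
      Finset.sum_congr rfl fun x _ => by
        simp only [hw, pow_zero, mul_one]
        rw [mul_assoc, ← Real.exp_add]
        congr 2
        ring
    have g := sum_mul_log_le (p := w) (f := f)
      (g := fun x => Real.exp (t * a x) * (W / heat a p 0 τ (θ + t))) hw0 (fun x => (hf x).le)
      (fun x => mul_pos (Real.exp_pos _) (div_pos hW (hZ _))) (by
        simp only [← mul_assoc, ← Finset.sum_mul]
        rw [eZt, eW, mul_div_cancel₀ _ (hZ _).ne'])
    have e : ∀ x, w x * (f x * Real.log (Real.exp (t * a x) * (W / heat a p 0 τ (θ + t)))) =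
        t * (w x * f x * a x) + w x * f x * (Real.log W - Real.log (heat a p 0 τ (θ + t))) := by
      intro x
      rw [Real.log_mul (Real.exp_pos _).ne' (div_pos hW (hZ _)).ne', Real.log_exp,
        Real.log_div hW.ne' (hZ _).ne']
      ring
    rw [Finset.sum_congr rfl fun x _ => e x, Finset.sum_add_distrib, ← Finset.mul_sum,
      ← Finset.sum_mul, eW, eW1] at g
    have h := mul_le_mul_of_nonneg_left (log_heat_add_le hp hK θ t) hW.le
    rw [eE, Real.log_div hW.ne' (hZ _).ne']
    nlinarith [g, h]
  have hd := discrim_le_zero key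
  rw [discrim] at hd
  linarith

variable (a q f) in
/-- The time derivative of `entFlow`. -/
noncomputable def entFlowTime (τ θ : ℝ) : ℝ :=
  heat a (fun x => q x * (f x * Real.log (f x))) 2 τ θ / 2 -
    (heat a (fun x => q x * f x) 2 τ θ / 2 *
        Real.log (heat a (fun x => q x * f x) 0 τ θ / heat a q 0 τ θ) +
      heat a (fun x => q x * f x) 2 τ θ / 2 -
      heat a (fun x => q x * f x) 0 τ θ * (moment a q 2 τ θ / 2))

variable (a q f) in
/-- The first space derivative of `entFlow`. -/
noncomputable def entFlowSpace (τ θ : ℝ) : ℝ :=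
  heat a (fun x => q x * (f x * Real.log (f x))) 1 τ θ -
    (heat a (fun x => q x * f x) 1 τ θ *
        Real.log (heat a (fun x => q x * f x) 0 τ θ / heat a q 0 τ θ) +
      heat a (fun x => q x * f x) 1 τ θ -
      heat a (fun x => q x * f x) 0 τ θ * (heat a q 1 τ θ / heat a q 0 τ θ))

variable (a q f) in
/-- The square by which `entFlow` fails to solve the heat equation. -/
noncomputable def entFlowDefect (τ θ : ℝ) : ℝ :=
  (heat a (fun x => q x * f x) 1 τ θ -
    heat a (fun x => q x * f x) 0 τ θ * moment a q 1 τ θ) ^ 2 /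
      heat a (fun x => q x * f x) 0 τ θ

lemma exists_mul_pos {Ω : Type*} {q f : Ω → ℝ} (hf : ∀ x, 0 < f x) (hq' : ∃ x, 0 < q x) : ∃ x, 0 < q x * f x :=
  hq'.imp fun x hx => mul_pos hx (hf x)

/-- The entropy is S - W log(W/Z) with S, W, Z solving the heat equation. A nonlinear function of
solutions fails the equation by half its Hessian, and the Hessian of W log(W/Z) along (W', Z') is
(W' - W Z'/Z)²/W, the defect. -/
lemma parabolicDerivs_entFlow (hq : ∀ x, 0 ≤ q x) (hq' : ∃ x, 0 < q x) (hf : ∀ x, 0 < f x) :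
    ParabolicDerivs (entFlow a q f) (entFlowTime a q f) (entFlowSpace a q f)
      (fun τ θ => 2 * entFlowTime a q f τ θ - entFlowDefect a q f τ θ) := by
  have hZ := fun t y => (heat_pos (a := a) hq hq' t y).ne'
  have hW := fun t y => (heat_pos (a := a) (fun x => mul_nonneg (hq x) (hf x).le)
    (exists_mul_pos hf hq') t y).ne'
  have hWZ := fun t y => div_ne_zero (hW t y) (hZ t y)
  refine ⟨fun τ θ => ?_, fun τ θ => ?_, fun τ θ => ?_⟩
  · simp only [entFlow_eq]
    have S := hasDerivAt_heat_time a (fun x => q x * (f x * Real.log (f x))) 0 τ θ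
    have W := hasDerivAt_heat_time a (fun x => q x * f x) 0 τ θ
    have Z := hasDerivAt_heat_time a q 0 τ θ
    refine (S.sub (W.mul ((W.div Z (hZ _ _)).log (hWZ _ _)))).congr_deriv ?_
    simp only [entFlowTime, moment]
    have h1 := hZ τ θ
    have h2 := hW τ θ
    norm_num
    field_simp
    ring
  · simp only [entFlow_eq]
    have S := hasDerivAt_heat_space a (fun x => q x * (f x * Real.log (f x))) 0 τ θ
    have W := hasDerivAt_heat_space a (fun x => q x * f x) 0 τ θ
    have Z := hasDerivAt_heat_space a q 0 τ θ
    refine (S.sub (W.mul ((W.div Z (hZ _ _)).log (hWZ _ _)))).congr_deriv ?_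
    simp only [entFlowSpace]
    have h1 := hZ τ θ
    have h2 := hW τ θ
    norm_num
    field_simp
    ring
  · simp only [entFlowSpace]
    have S := hasDerivAt_heat_space a (fun x => q x * (f x * Real.log (f x))) 1 τ θ
    have W := hasDerivAt_heat_space a (fun x => q x * f x) 0 τ θ
    have Z := hasDerivAt_heat_space a q 0 τ θ
    have W' := hasDerivAt_heat_space a (fun x => q x * f x) 1 τ θ
    have Z' := hasDerivAt_heat_space a q 1 τ θ
    refine (S.sub (((W'.mul ((W.div Z (hZ _ _)).log (hWZ _ _))).add W').sub
      (W.mul (Z'.div Z (hZ _ _))))).congr_deriv ?_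
    simp only [entFlowTime, entFlowDefect, moment]
    have h1 := hZ τ θ
    have h2 := hW τ θ
    norm_num
    field_simp
    ring

lemma continuous_entFlow (hq : ∀ x, 0 ≤ q x) (hq' : ∃ x, 0 < q x) (hf : ∀ x, 0 < f x) :
    Continuous fun z : ℝ × ℝ => entFlow a q f z.1 z.2 := by
  have hZ := fun z : ℝ × ℝ => (heat_pos (a := a) hq hq' z.1 z.2).ne'
  have hW := fun z : ℝ × ℝ => (heat_pos (a := a) (fun x => mul_nonneg (hq x) (hf x).le)
    (exists_mul_pos hf hq') z.1 z.2).ne'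
  simp only [entFlow_eq]
  exact (continuous_heat _ _ _).sub ((continuous_heat _ _ _).mul
    (((continuous_heat _ _ _).div (continuous_heat _ _ _) hZ).log
      fun z => div_ne_zero (hW z) (hZ z)))

lemma entFlow_le_exp [Nonempty Ω] (hp : ∀ x, 0 < p x) (hf : ∀ x, 0 < f x) :
    ∃ A M, ∀ τ ∈ Set.Icc (0 : ℝ) 1, ∀ θ,
      entFlow a p f τ θ ≤ A * Real.exp (M * |θ|) := by
  obtain ⟨R, hR⟩ := exists_abs_le a
  refine ⟨(∑ x, |p x * (f x * Real.log (f x))|) * Real.exp (R ^ 2 / 2) +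
    (∑ x, |p x|) * Real.exp (R ^ 2 / 2), R, fun τ hτ θ => ?_⟩
  have hpf : ∀ x, 0 < p x * f x := fun x => mul_pos (hp x) (hf x)
  have hZ := heat_pos (a := a) (fun x => (hp x).le) ⟨Classical.arbitrary Ω, hp _⟩ τ θ
  have hW := heat_pos (a := a) (fun x => (hpf x).le) ⟨Classical.arbitrary Ω, hpf _⟩ τ θ
  have h1 := heat_le_exp (q := fun x => p x * (f x * Real.log (f x))) hR hτ θ
  have h2 := heat_le_exp (q := p) hR hτ θ
  -- This gives -W log(W/Z) ≤ Z - W, so no lower bound on W/Z is needed.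
  have h3 := sub_le_mul_log_sub hW.le hZ
  rw [entFlow_eq, Real.log_div hW.ne' hZ.ne', add_mul]
  linarith

/-- Approximate tensorization of entropy is transported along the flow, with a loss governed by
the variance of `a` at time `0`. -/
theorem entFlow_one_le [Nonempty Ω] {J : Type*} [Fintype J] {χ : J → Ω → ℝ}
    (hp : ∀ x, 0 < p x) (hf : ∀ x, 0 < f x) (hχ : ∀ j x, 0 ≤ χ j x) (hχ' : ∀ j, ∃ x, 0 < χ j x)
    {s : ℝ} (hs : s < 1) (hvar : ∀ θ, moment a p 2 0 θ - moment a p 1 0 θ ^ 2 ≤ s)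
    (h0 : ∀ θ, entFlow a p f 0 θ ≤ ∑ j, entFlow a (fun x => χ j x * p x) f 0 θ) :
    (1 - s) * entFlow a p f 1 0 ≤ ∑ j, entFlow a (fun x => χ j x * p x) f 1 0 := by
  have hp' : ∃ x, 0 < p x := ⟨Classical.arbitrary Ω, hp _⟩
  have hq : ∀ j x, 0 ≤ χ j x * p x := fun j x => mul_nonneg (hχ j x) (hp x).le
  have hq' : ∀ j, ∃ x, 0 < χ j x * p x := fun j => (hχ' j).imp fun x hx => mul_pos hx (hp x)
  have dE := parabolicDerivs_entFlow (a := a) (fun x => (hp x).le) hp' hf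
  have dT := fun j => parabolicDerivs_entFlow (a := a) (hq j) (hq' j) hf
  obtain ⟨A, M, hAM⟩ := entFlow_le_exp (a := a) hp hf
  have main := parabolic_max_principle
    (G := fun t y => ∑ j, entFlow a (fun x => χ j x * p x) f t y -
      (1 - t * s) * entFlow a p f t y)
    (Gt := fun t y => ∑ j, entFlowTime a (fun x => χ j x * p x) f t y -
      ((1 - t * s) * entFlowTime a p f t y - s * entFlow a p f t y))
    (G1 := fun t y => ∑ j, entFlowSpace a (fun x => χ j x * p x) f t y -
      (1 - t * s) * entFlowSpace a p f t y)
    (G2 := fun t y => ∑ j, (2 * entFlowTime a (fun x => χ j x * p x) f t y -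
        entFlowDefect a (fun x => χ j x * p x) f t y) -
      (1 - t * s) * (2 * entFlowTime a p f t y - entFlowDefect a p f t y))
    (b := fun _ _ => 0) (c := fun _ _ => 0) (B := 0) (A := (1 + |s|) * A) (M := M)
    ?_ ⟨fun t y => ?_, fun t y => ?_, fun t y => ?_⟩ (by simp) (by simp) (fun t ht y => ?_)
    (fun t ht y => ?_) (fun y => ?_) (Set.right_mem_Icc.2 zero_le_one) 0
  · linarith
  · have h1 := continuous_entFlow (a := a) (fun x => (hp x).le) hp' hf
    have h2 := fun j => continuous_entFlow (a := a) (hq j) (hq' j) hf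
    simp only [Function.uncurry_def]
    fun_prop
  · refine ((HasDerivAt.fun_sum fun j _ => (dT j).time t y).sub
      ((((hasDerivAt_id t).mul_const s).const_sub 1).mul (dE.time t y))).congr_deriv ?_
    simp only [id]
    ring
  · exact (HasDerivAt.fun_sum fun j _ => (dT j).space t y).sub
      ((dE.space t y).const_mul (1 - t * s))
  · exact (HasDerivAt.fun_sum fun j _ => (dT j).space₂ t y).sub
      ((dE.space₂ t y).const_mul (1 - t * s))
  -- The edge defects have the favourable sign and are dropped; what remains is (1 - t s) · defect ≤
  -- 2 s E, supplied by the variance bound K = s/(1 - t s).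
  · have hpos : 0 < 1 - t * s := by
      rcases le_total s 0 with h | h
      · nlinarith [ht.1]
      · nlinarith [ht.2]
    have hK : ∀ θ, moment a p 2 t θ - moment a p 1 t θ ^ 2 ≤ s / (1 - t * s) := fun θ => by
      rw [le_div_iff₀ hpos, mul_comm]
      exact variance_flow_le hp hvar ht θ
    have hpf : ∀ x, 0 < p x * f x := fun x => mul_pos (hp x) (hf x)
    have hW := heat_pos (a := a) (fun x => (hpf x).le) ⟨Classical.arbitrary Ω, hpf _⟩ t y
    have h1 := sq_mean_shift_le hp hf hK y
    have h2 : (1 - t * s) * entFlowDefect a p f t y ≤ 2 * (s * entFlow a p f t y) := by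
      rw [entFlowDefect, ← mul_div_assoc, div_le_iff₀ hW]
      refine (mul_le_mul_of_nonneg_left h1 hpos.le).trans (le_of_eq ?_)
      field_simp
    have h3 : 0 ≤ ∑ j, entFlowDefect a (fun x => χ j x * p x) f t y :=
      Finset.sum_nonneg fun j _ => div_nonneg (sq_nonneg _)
        (heat_pos (fun x => mul_nonneg (hq j x) (hf x).le) (exists_mul_pos hf (hq' j)) t y).le
    rw [Finset.sum_sub_distrib, ← Finset.mul_sum]
    linarith
  · have h1 : 0 ≤ ∑ j, entFlow a (fun x => χ j x * p x) f t y :=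
      Finset.sum_nonneg fun j _ => entFlow_nonneg (hq j) (fun x => (hf x).le) t y
    have h2 : 1 - t * s ≤ 1 + |s| := by
      have := mul_le_mul_of_nonneg_right ht.2 (abs_nonneg s)
      have h := neg_abs_le (t * s)
      rw [abs_mul, abs_of_nonneg ht.1] at h
      linarith
    have h3 := mul_le_mul h2 (hAM t ht y)
      (entFlow_nonneg (fun x => (hp x).le) (fun x => (hf x).le) t y) (by positivity)
    linarith
  · have := h0 y
    simp only [zero_mul, sub_zero, one_mul]
    linarith

end HeatFlow

/-! ### Approximate tensorization of entropy for the rank-one Ising model -/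

lemma inner_toVec {n : ℕ} (v : EuclideanSpace ℝ (Fin n)) (x : Cube n) :
    inner ℝ v (toVec x) = ∑ i, v i * ((x i : ℤ) : ℝ) := by
  simp only [PiLp.inner_apply, toVec]
  exact Finset.sum_congr rfl fun i _ => by simp [mul_comm]

/-- The weight `exp ⟨h, x⟩` of the external field. -/
noncomputable def fieldWeight {n : ℕ} (h : EuclideanSpace ℝ (Fin n)) (x : Cube n) : ℝ :=
  Real.exp (inner ℝ h (toVec x))

lemma fieldWeight_pos {n : ℕ} (h : EuclideanSpace ℝ (Fin n)) (x : Cube n) : 0 < fieldWeight h x :=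
  Real.exp_pos _

lemma fieldWeight_mul_exp {n : ℕ} (u h : EuclideanSpace ℝ (Fin n)) (θ : ℝ) (x : Cube n) :
    fieldWeight h x * Real.exp (0 * (inner ℝ u (toVec x) ^ 2 / 2) + θ * inner ℝ u (toVec x)) =
      ∏ i, Real.exp ((h i + θ * u i) * ((x i : ℤ) : ℝ)) := by
  rw [fieldWeight, ← Real.exp_add, ← Real.exp_sum, inner_toVec, inner_toVec, zero_mul, zero_add,
    Finset.mul_sum, ← Finset.sum_add_distrib]
  congr 1
  exact Finset.sum_congr rfl fun i _ => by ring

lemma heat_fieldWeight {n : ℕ} (u h : EuclideanSpace ℝ (Fin n)) (θ : ℝ) :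
    heat (fun x => inner ℝ u (toVec x)) (fieldWeight h) 0 0 θ =
      ∏ i, (2 * Real.cosh (h i + θ * u i)) := by
  have e : ∀ i, 2 * Real.cosh (h i + θ * u i) =
      ∑ s : ℤˣ, Real.exp ((h i + θ * u i) * ((s : ℤ) : ℝ)) := fun i => by
    rw [show (Finset.univ : Finset ℤˣ) = {1, -1} from rfl, Finset.sum_pair (by decide),
      Real.cosh_eq]
    simp
    ring
  simp only [e]
  rw [Finset.prod_univ_sum, Fintype.piFinset_univ]
  refine Finset.sum_congr rfl fun x _ => ?_
  rw [pow_zero, mul_one, fieldWeight_mul_exp]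

/-- Both sides are the θ-derivative of the log-partition function, which is a sum over coordinates
because the weight factors. -/
lemma moment_one_fieldWeight {n : ℕ} (u h : EuclideanSpace ℝ (Fin n)) (θ : ℝ) :
    moment (fun x => inner ℝ u (toVec x)) (fieldWeight h) 1 0 θ =
      ∑ i, u i * (Real.sinh (h i + θ * u i) / Real.cosh (h i + θ * u i)) := by
  have hne : heat (fun x => inner ℝ u (toVec x)) (fieldWeight h) 0 0 θ ≠ 0 :=
    (heat_pos (fun x => (fieldWeight_pos h x).le) ⟨1, fieldWeight_pos h 1⟩ 0 θ).ne'
  refine ((hasDerivAt_heat_space _ (fieldWeight h) 0 0 θ).log hne).unique ?_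
  have e : (fun y => Real.log (heat (fun x => inner ℝ u (toVec x)) (fieldWeight h) 0 0 y)) =
      fun y => ∑ i, Real.log (2 * Real.cosh (h i + y * u i)) := by
    funext y
    rw [heat_fieldWeight, Real.log_prod fun i _ => (mul_pos two_pos (Real.cosh_pos _)).ne']
  rw [e]
  refine (HasDerivAt.fun_sum fun i _ => ((((hasDerivAt_id θ).mul_const (u i)).const_add
    (h i)).cosh.const_mul 2).log (mul_pos two_pos (Real.cosh_pos _)).ne').congr_deriv ?_
  refine Finset.sum_congr rfl fun i _ => ?_
  have := (Real.cosh_pos (h i + θ * u i)).ne'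
  simp only [id]
  field_simp

/-- The coordinates are independent at τ = 0, and the i-th contributes u_i²/cosh² ≤ u_i², uniformly
in θ. -/
lemma variance_fieldWeight_le {n : ℕ} (u h : EuclideanSpace ℝ (Fin n)) (θ : ℝ) :
    moment (fun x => inner ℝ u (toVec x)) (fieldWeight h) 2 0 θ -
      moment (fun x => inner ℝ u (toVec x)) (fieldWeight h) 1 0 θ ^ 2 ≤ ‖u‖ ^ 2 := by
  have h1 := hasDerivAt_moment_space (a := fun x => inner ℝ u (toVec x)) (fieldWeight_pos h) 1 0 θ
  rw [funext (moment_one_fieldWeight u h)] at h1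
  have hc := fun i => (Real.cosh_pos (h i + θ * u i)).ne'
  have h2 := h1.unique (HasDerivAt.fun_sum fun i (_ : i ∈ Finset.univ) =>
    ((((hasDerivAt_id θ).mul_const (u i)).const_add (h i)).sinh.div
      (((hasDerivAt_id θ).mul_const (u i)).const_add (h i)).cosh (hc i)).const_mul (u i))
  rw [sq, moment_one_fieldWeight, EuclideanSpace.real_norm_sq_eq]
  refine (le_of_eq h2).trans ?_
  refine Finset.sum_le_sum fun i _ => ?_
  have hc0 := Real.cosh_pos (h i + θ * u i)
  have h3 : u i * ((Real.cosh (h i + θ * u i) * (1 * u i) * Real.cosh (h i + θ * u i) -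
      Real.sinh (h i + θ * u i) * (Real.sinh (h i + θ * u i) * (1 * u i))) /
        Real.cosh (h i + θ * u i) ^ 2) = u i ^ 2 / Real.cosh (h i + θ * u i) ^ 2 := by
    have := Real.cosh_sq (h i + θ * u i)
    rw [← mul_div_assoc]
    congr 1
    linear_combination u i ^ 2 * this
  refine (le_of_eq h3).trans (div_le_self (sq_nonneg _) ?_)
  exact one_le_pow₀ (Real.one_le_cosh _)

/-- Half the counting measure of the edge through `x` in direction `i`. -/
noncomputable def edgeMass {n : ℕ} (j : Fin n × Cube n) (z : Cube n) : ℝ :=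
  ∑ s : ℤˣ, if Function.update j.2 j.1 s = z then 1 / 2 else 0

lemma sum_edgeMass_mul {n : ℕ} (j : Fin n × Cube n) (F : Cube n → ℝ) :
    ∑ z, edgeMass j z * F z = (1 / 2) * ∑ s : ℤˣ, F (Function.update j.2 j.1 s) := by
  simp only [edgeMass, Finset.sum_mul, ite_mul, zero_mul]
  rw [Finset.sum_comm, Finset.mul_sum]
  simp

/-- Writing an edge entropy as an entropy for a reweighting of p lets the edges follow the same
tilting flow as p. -/
lemma wEnt_edgeMass {n : ℕ} (j : Fin n × Cube n) (p f : Cube n → ℝ) :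
    wEnt (fun z => edgeMass j z * p z) f =
      (1 / 2) * wEnt (fun s => p (Function.update j.2 j.1 s))
        (fun s => f (Function.update j.2 j.1 s)) := by
  rw [← wEnt_smul]
  simp only [wEnt, mul_assoc, sum_edgeMass_mul, Finset.mul_sum]

lemma sum_wEnt_edgeMass {n : ℕ} (p f : Cube n → ℝ) :
    ∑ j, wEnt (fun z => edgeMass j z * p z) f = ∑ i, edgeEnt p f i := by
  simp only [wEnt_edgeMass, edgeEnt, Finset.mul_sum]
  rw [Fintype.sum_prod_type]

lemma isingWeight_eq {n : ℕ} (u h : EuclideanSpace ℝ (Fin n)) (x : Cube n) :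
    isingWeight u h x = fieldWeight h x *
      Real.exp (1 * (inner ℝ u (toVec x) ^ 2 / 2) + 0 * inner ℝ u (toVec x)) := by
  rw [isingWeight, fieldWeight, ← Real.exp_add]
  congr 1
  ring

lemma isingWeight_pos {n : ℕ} (u h : EuclideanSpace ℝ (Fin n)) (x : Cube n) :
    0 < isingWeight u h x := Real.exp_pos _

lemma edgeEnt_nonneg {n : ℕ} {p f : Cube n → ℝ} (hp : ∀ x, 0 ≤ p x) (hf : ∀ x, 0 ≤ f x)
    (i : Fin n) : 0 ≤ edgeEnt p f i :=
  mul_nonneg (by norm_num) (Finset.sum_nonneg fun _ _ => wEnt_nonneg (fun _ => hp _) fun _ => hf _)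

lemma continuous_edgeEnt {n : ℕ} (p : Cube n → ℝ) (i : Fin n) :
    Continuous fun f => edgeEnt p f i :=
  continuous_const.mul (continuous_finsetSum _ fun _ _ =>
    (continuous_wEnt _).comp (continuous_pi fun _ => continuous_apply _))

/-- At time 0 the tilt by θ only changes the external field to h + θ u, so product tensorization
supplies the initial condition for every θ. -/
theorem wEnt_isingWeight_le_of_pos {n : ℕ} (u h : EuclideanSpace ℝ (Fin n)) (hu : ‖u‖ ^ 2 < 1)
    {f : Cube n → ℝ} (hf : ∀ x, 0 < f x) :
    (1 - ‖u‖ ^ 2) * wEnt (isingWeight u h) f ≤ ∑ i, edgeEnt (isingWeight u h) f i := by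
  have key := entFlow_one_le (a := fun x : Cube n => inner ℝ u (toVec x)) (χ := edgeMass)
    (fieldWeight_pos h) hf
    (fun j z => Finset.sum_nonneg fun s _ => by split_ifs <;> norm_num)
    (fun j => ⟨j.2, Finset.sum_pos' (fun s _ => by split_ifs <;> norm_num)
      ⟨j.2 j.1, Finset.mem_univ _, by simp⟩⟩)
    hu (variance_fieldWeight_le u h) (fun θ => by
      simp only [entFlow, mul_assoc (edgeMass _ _), fieldWeight_mul_exp]
      rw [sum_wEnt_edgeMass]
      exact wEnt_pi_le (p := fun i s => Real.exp ((h i + θ * u i) * ((s : ℤ) : ℝ)))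
        (fun i s => Real.exp_pos _) hf)
  simp only [entFlow, mul_assoc (edgeMass _ _), ← isingWeight_eq] at key
  rwa [sum_wEnt_edgeMass] at key

/-- Approximate tensorization of entropy for the rank-one Ising model. -/
theorem wEnt_isingWeight_le {n : ℕ} (u h : EuclideanSpace ℝ (Fin n))
    {f : Cube n → ℝ} (hf : ∀ x, 0 ≤ f x) :
    (1 - ‖u‖ ^ 2) * wEnt (isingWeight u h) f ≤ ∑ i, edgeEnt (isingWeight u h) f i := by
  rcases lt_or_ge (‖u‖ ^ 2) 1 with hu | hu
  · have hlim : Filter.Tendsto (fun ε : ℝ => fun x => f x + ε) (nhdsWithin 0 (Set.Ioi 0))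
        (nhds f) := by
      have : Continuous fun ε : ℝ => fun x => f x + ε := by fun_prop
      simpa using (this.tendsto 0).mono_left nhdsWithin_le_nhds
    refine le_of_tendsto_of_tendsto (((continuous_wEnt (isingWeight u h)).tendsto f).comp hlim
      |>.const_mul (1 - ‖u‖ ^ 2)) (((continuous_finsetSum Finset.univ fun i _ =>
        continuous_edgeEnt (isingWeight u h) i).tendsto f).comp hlim) ?_
    filter_upwards [self_mem_nhdsWithin] with ε hε
    exact wEnt_isingWeight_le_of_pos u h hu fun x => add_pos_of_nonneg_of_pos (hf x) hε
  -- For ‖u‖ ≥ 1 the left side is nonpositive and nothing is to be proved.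
  · have hp := fun x => (isingWeight_pos u h x).le
    exact (mul_nonpos_of_nonpos_of_nonneg (by linarith) (wEnt_nonneg hp hf)).trans
      (Finset.sum_nonneg fun i _ => edgeEnt_nonneg hp hf i)

/-! ### Sums along edges of the cube -/

section Edges

variable {n : ℕ}

/-- The mass of the edge through `x` in direction `i`. -/
noncomputable def edgeSum (m : Cube n → ℝ) (i : Fin n) (x : Cube n) : ℝ :=
  ∑ s : ℤˣ, m (Function.update x i s)

lemma edgeSum_pos {m : Cube n → ℝ} (hm : ∀ x, 0 < m x) (i : Fin n) (x : Cube n) :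
    0 < edgeSum m i x := Finset.sum_pos (fun _ _ => hm _) Finset.univ_nonempty

lemma edgeSum_nonneg {m : Cube n → ℝ} (hm : ∀ x, 0 ≤ m x) (i : Fin n) (x : Cube n) :
    0 ≤ edgeSum m i x := Finset.sum_nonneg fun _ _ => hm _

lemma edgeSum_update (m : Cube n → ℝ) (i : Fin n) (x : Cube n) (s : ℤˣ) :
    edgeSum m i (Function.update x i s) = edgeSum m i x := by
  simp [edgeSum]

lemma sum_agree_off (F : Cube n → ℝ) (i : Fin n) (x : Cube n) :
    ∑ y, (if ∀ j, j ≠ i → y j = x j then F y else 0) = edgeSum F i x := by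
  have h : (Finset.univ.filter fun y : Cube n => ∀ j, j ≠ i → y j = x j) =
      Finset.univ.image fun s : ℤˣ => Function.update x i s := by
    ext y
    simp only [Finset.mem_filter, Finset.mem_univ, true_and, Finset.mem_image]
    constructor
    · intro hy
      refine ⟨y i, ?_⟩
      funext j
      rcases eq_or_ne j i with rfl | hj
      · simp
      · rw [Function.update_of_ne hj, hy j hj]
    · rintro ⟨s, rfl⟩ j hj
      exact Function.update_of_ne hj _ _
  rw [← Finset.sum_filter, h, Finset.sum_image (Function.update_injective x i).injOn]
  rfl

lemma sum_edgeSum (F : Cube n → ℝ) (i : Fin n) : ∑ x, edgeSum F i x = 2 * ∑ x, F x := by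
  -- After reindexing by s * x i, each fixed s acts as an involution of the cube: s = 1 fixes x, s =
  -- -1 flips coordinate i.
  have h1 : ∀ x : Cube n, edgeSum F i x = ∑ s : ℤˣ, F (Function.update x i (s * x i)) := fun x =>
    (Equiv.sum_comp (Equiv.mulRight (x i)) fun s => F (Function.update x i s)).symm
  have h2 : ∀ s : ℤˣ, ∑ x : Cube n, F (Function.update x i (s * x i)) = ∑ x, F x := by
    intro s
    have hinv : Function.Involutive fun x : Cube n => Function.update x i (s * x i) := by
      intro x
      simp [← mul_assoc, Int.units_mul_self]
    exact Equiv.sum_comp (hinv.toPerm _) F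
  rw [Finset.sum_congr rfl fun x _ => h1 x, Finset.sum_comm]
  simp [h2]

lemma sum_edgeSum_mul (F G : Cube n → ℝ) (i : Fin n)
    (hG : ∀ x s, G (Function.update x i s) = G x) :
    ∑ x, edgeSum F i x * G x = 2 * ∑ x, F x * G x := by
  rw [← sum_edgeSum (fun x => F x * G x) i]
  simp only [edgeSum, hG, Finset.sum_mul]

/-- Chain rule: the logarithm of the conditional mean is constant along edges, so edge averaging
drops out and the 1/2 cancels the double counting. -/
lemma edgeEnt_eq (p f : Cube n → ℝ) (i : Fin n) :
    edgeEnt p f i = ∑ x, p x * (f x * Real.log (f x)) - ∑ x, p x * f x *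
      Real.log (edgeSum (fun y => p y * f y) i x / edgeSum p i x) := by
  have h1 := sum_edgeSum (fun x => p x * (f x * Real.log (f x))) i
  have h2 := sum_edgeSum_mul (fun x => p x * f x)
    (fun x => Real.log (edgeSum (fun y => p y * f y) i x / edgeSum p i x)) i fun x s => by
      rw [edgeSum_update, edgeSum_update]
  have h3 : edgeEnt p f i = (1 / 2) * (∑ x, edgeSum (fun x => p x * (f x * Real.log (f x))) i x -
      ∑ x, edgeSum (fun x => p x * f x) i x *
        Real.log (edgeSum (fun y => p y * f y) i x / edgeSum p i x)) := by
    rw [← Finset.sum_sub_distrib]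
    rfl
  rw [h3, h1, h2]
  ring

lemma edgeEnt_smul (c : ℝ) (p f : Cube n → ℝ) (i : Fin n) :
    edgeEnt (fun x => c * p x) f i = c * edgeEnt p f i := by
  simp only [edgeEnt, wEnt_smul, ← Finset.mul_sum]
  ring

/-! ### The Glauber dynamics -/

lemma sum_glauber_mul (m F : Cube n → ℝ) (x : Cube n) :
    ∑ y, glauber m x y * F y =
      (1 / (n : ℝ)) * ∑ i, edgeSum (fun y => m y * F y) i x / edgeSum m i x := by
  simp only [glauber, mul_assoc, ← Finset.mul_sum, Finset.sum_mul]
  rw [Finset.sum_comm]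
  congr 1
  refine Finset.sum_congr rfl fun i _ => ?_
  rw [← sum_agree_off, Finset.sum_div]
  refine Finset.sum_congr rfl fun y _ => ?_
  change _ = _ / ∑ s : ℤˣ, m (Function.update x i s)
  split_ifs <;> ring

lemma vecMul_glauber (m ν : Cube n → ℝ) (y : Cube n) :
    Matrix.vecMul ν (glauber m) y =
      (1 / (n : ℝ)) * ∑ i, m y * (edgeSum ν i y / edgeSum m i y) := by
  simp only [Matrix.vecMul, dotProduct, glauber, mul_left_comm (ν _), ← Finset.mul_sum]
  congr 1
  simp only [Finset.mul_sum]
  rw [Finset.sum_comm]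
  refine Finset.sum_congr rfl fun i _ => ?_
  rw [← sum_agree_off, Finset.sum_div, Finset.mul_sum]
  refine Finset.sum_congr rfl fun x _ => ?_
  by_cases hx : ∀ j, j ≠ i → x j = y j
  · have e : edgeSum m i x = edgeSum m i y := by
      rw [← edgeSum_update m i x (y i)]
      congr 1
      funext j
      rcases eq_or_ne j i with rfl | hj
      · simp
      · rw [Function.update_of_ne hj, hx j hj]
    rw [if_pos hx, if_pos fun j hj => (hx j hj).symm]
    change ν x * (m y / edgeSum m i x) = _
    rw [e]
    ring
  · rw [if_neg hx, if_neg fun h => hx fun j hj => (h j hj).symm]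
    ring

lemma vecMul_glauber_self {m : Cube n → ℝ} (hn : n ≠ 0) (hm : ∀ x, 0 < m x) :
    Matrix.vecMul m (glauber m) = m := by
  funext y
  rw [vecMul_glauber]
  simp only [div_self (edgeSum_pos hm _ y).ne', mul_one, Finset.sum_const, Finset.card_univ,
    Fintype.card_fin, nsmul_eq_mul]
  field_simp

lemma glauber_nonneg {m : Cube n → ℝ} (hm : ∀ x, 0 < m x) (x y : Cube n) :
    0 ≤ glauber m x y := by
  refine mul_nonneg (by positivity) (Finset.sum_nonneg fun i _ => ?_)
  split_ifs
  · exact div_nonneg (hm y).le (edgeSum_pos hm i x).le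
  · exact le_rfl

/-! ### The down operator -/

/-- The element of `[n] ∪ [n̄]` recording the `i`-th coordinate of `x`. -/
def homElem (x : Cube n) (i : Fin n) : Fin n ⊕ Fin n := if x i = 1 then Sum.inl i else Sum.inr i

lemma homElem_injective (x : Cube n) : Function.Injective (homElem x) := by
  intro i j h
  unfold homElem at h
  split_ifs at h <;> simpa using h

lemma homElem_mem_homSet (x z : Cube n) (i : Fin n) : homElem x i ∈ homSet z ↔ z i = x i := by
  rcases Int.units_eq_one_or (x i) with h | h <;> simp [homElem, homSet, h]

lemma homSet_eq_image (x : Cube n) : homSet x = Finset.univ.image (homElem x) := by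
  symm
  refine Finset.eq_of_subset_of_card_le (fun e he => ?_) ?_
  · obtain ⟨i, -, rfl⟩ := Finset.mem_image.1 he
    exact (homElem_mem_homSet x x i).2 rfl
  · rw [Finset.card_image_of_injective _ (homElem_injective x), card_homSet]
    simp

/-- The set `homSet x` with its element over `i` removed. -/
def downSet (x : Cube n) (i : Fin n) : {T : Finset (Fin n ⊕ Fin n) // T.card = n - 1} :=
  ⟨(Finset.univ.erase i).image (homElem x), by
    rw [Finset.card_image_of_injective _ (homElem_injective x),
      Finset.card_erase_of_mem (Finset.mem_univ i)]
    simp⟩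

lemma downSet_subset_homSet (x z : Cube n) (i : Fin n) :
    (downSet x i).1 ⊆ homSet z ↔ ∀ j, j ≠ i → z j = x j := by
  simp only [downSet, Finset.image_subset_iff, Finset.mem_erase, Finset.mem_univ, and_true,
    homElem_mem_homSet]

lemma downSet_injective (x : Cube n) : Function.Injective (downSet x) := by
  intro i j h
  by_contra hij
  have h1 : homElem x i ∈ (downSet x j).1 :=
    Finset.mem_image_of_mem _ (Finset.mem_erase.2 ⟨hij, Finset.mem_univ i⟩)
  rw [← h] at h1
  obtain ⟨k, hk, hki⟩ := Finset.mem_image.1 h1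
  exact (Finset.mem_erase.1 hk).1 (homElem_injective x hki)

lemma exists_eq_downSet (hn : n ≠ 0) (x : Cube n)
    (T : {T : Finset (Fin n ⊕ Fin n) // T.card = n - 1}) (hT : T.1 ⊆ homSet x) :
    ∃ i, downSet x i = T := by
  have h1 : (homSet x \ T.1).card = 1 := by
    rw [Finset.card_sdiff_of_subset hT, card_homSet, T.2]
    omega
  obtain ⟨e, he⟩ := Finset.card_eq_one.1 h1
  have he' : e ∈ homSet x \ T.1 := he ▸ Finset.mem_singleton_self e
  rw [Finset.mem_sdiff, homSet_eq_image, Finset.mem_image] at he'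
  obtain ⟨⟨i, -, rfl⟩, hi⟩ := he'
  refine ⟨i, Subtype.ext (Finset.eq_of_subset_of_card_le ?_ (by rw [T.2, (downSet x i).2])).symm⟩
  intro e he''
  have h2 := hT he''
  rw [homSet_eq_image, Finset.mem_image] at h2
  obtain ⟨j, -, rfl⟩ := h2
  refine Finset.mem_image_of_mem _ (Finset.mem_erase.2 ⟨?_, Finset.mem_univ j⟩)
  rintro rfl
  exact hi he''

lemma sum_subset_homSet (hn : n ≠ 0) (x : Cube n)
    (F : {T : Finset (Fin n ⊕ Fin n) // T.card = n - 1} → ℝ) :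
    ∑ T, (if T.1 ⊆ homSet x then F T else 0) = ∑ i, F (downSet x i) := by
  have h : (Finset.univ.filter
      fun T : {T : Finset (Fin n ⊕ Fin n) // T.card = n - 1} => T.1 ⊆ homSet x) =
      Finset.univ.image (downSet x) := by
    ext T
    simp only [Finset.mem_filter, Finset.mem_univ, true_and, Finset.mem_image]
    refine ⟨exists_eq_downSet hn x T, ?_⟩
    rintro ⟨i, rfl⟩
    exact (downSet_subset_homSet x x i).2 fun _ _ => rfl
  rw [← Finset.sum_filter, h, Finset.sum_image (downSet_injective x).injOn]

lemma downDist_eq (hn : n ≠ 0) (m : Cube n → ℝ)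
    (T : {T : Finset (Fin n ⊕ Fin n) // T.card = n - 1}) :
    downDist m T = (1 / (n : ℝ)) * ∑ σ, if T.1 ⊆ homSet σ then m σ else 0 := by
  have hc : n.choose (n - 1) = n := by
    rw [Nat.choose_symm (Nat.one_le_iff_ne_zero.2 hn), Nat.choose_one_right]
  simp only [downDist, Matrix.vecMul, dotProduct, homogenize, Finset.sum_mul, ite_mul, zero_mul]
  rw [Finset.sum_comm, Finset.mul_sum]
  refine Finset.sum_congr rfl fun σ _ => ?_
  rw [Finset.sum_ite_eq, if_pos (Finset.mem_univ _), downOp, hc]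
  split_ifs <;> ring

lemma downDist_downSet (hn : n ≠ 0) (m : Cube n → ℝ) (x : Cube n) (i : Fin n) :
    downDist m (downSet x i) = (1 / (n : ℝ)) * edgeSum m i x := by
  rw [downDist_eq hn, ← sum_agree_off]
  simp only [downSet_subset_homSet]

lemma sum_downDist_mul (hn : n ≠ 0) (m : Cube n → ℝ)
    (F : {T : Finset (Fin n ⊕ Fin n) // T.card = n - 1} → ℝ) :
    ∑ T, downDist m T * F T = (1 / (n : ℝ)) * ∑ x, m x * ∑ i, F (downSet x i) := by
  simp only [downDist_eq hn, mul_assoc, ← Finset.mul_sum, Finset.sum_mul]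
  congr 1
  rw [Finset.sum_comm]
  refine Finset.sum_congr rfl fun x _ => ?_
  rw [← sum_subset_homSet hn, Finset.mul_sum]
  refine Finset.sum_congr rfl fun T _ => ?_
  split_ifs <;> simp

/-- As m is positive, its image vanishes only at sets contained in no `homSet`, where every image
vanishes. So the relative entropy after the down step is never ⊤. -/
lemma downDist_eq_zero (hn : n ≠ 0) {m ν : Cube n → ℝ} (hm : ∀ x, 0 < m x)
    {T : {T : Finset (Fin n ⊕ Fin n) // T.card = n - 1}} (hT : downDist m T = 0) :
    downDist ν T = 0 := by
  rw [downDist_eq hn] at hT ⊢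
  have h0 : (1 / (n : ℝ)) ≠ 0 := by positivity
  have h1 := (mul_eq_zero.1 hT).resolve_left h0
  rw [Finset.sum_eq_zero_iff_of_nonneg fun x _ => by split_ifs; exacts [(hm x).le, le_rfl]] at h1
  rw [Finset.sum_eq_zero, mul_zero]
  intro x hx
  have h2 := h1 x hx
  split_ifs with h
  · rw [if_pos h] at h2
    exact absurd h2 (hm x).ne'
  · rfl

/-! ### Relative entropies -/

lemma relEntropy_of_pos {Ω : Type*} [Fintype Ω] {ν m : Ω → ℝ} (hm : ∀ x, 0 < m x) :
    relEntropy ν m = ((∑ x, ν x * Real.log (ν x / m x) : ℝ) : EReal) := by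
  rw [relEntropy, if_pos fun x hx => absurd hx (hm x).ne']

lemma relEntropy_downDist (hn : n ≠ 0) {ν m : Cube n → ℝ} (hm : ∀ x, 0 < m x) :
    relEntropy (downDist ν) (downDist m) = (((1 / (n : ℝ)) * ∑ i, ∑ x,
      ν x * Real.log (edgeSum ν i x / edgeSum m i x) : ℝ) : EReal) := by
  rw [relEntropy, if_pos fun T hT => downDist_eq_zero hn hm hT, sum_downDist_mul hn,
    Finset.sum_comm]
  have h0 : (1 / (n : ℝ)) ≠ 0 := by positivity
  simp only [downDist_downSet hn, mul_div_mul_left _ _ h0, Finset.mul_sum]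

/-- The step of the dynamics after the down step does not increase relative entropy. -/
lemma relEntropy_vecMul_glauber_le (hn : n ≠ 0) {ν m : Cube n → ℝ} (hm : ∀ x, 0 < m x)
    (hν : ∀ x, 0 ≤ ν x) :
    relEntropy (Matrix.vecMul ν (glauber m)) (Matrix.vecMul m (glauber m)) ≤
      relEntropy (downDist ν) (downDist m) := by
  rw [vecMul_glauber_self hn hm, relEntropy_of_pos hm, relEntropy_downDist hn hm,
    EReal.coe_le_coe_iff]
  set r : Fin n → Cube n → ℝ := fun i x => edgeSum ν i x / edgeSum m i x with hr
  have hr0 : ∀ i x, 0 ≤ r i x := fun i x =>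
    div_nonneg (edgeSum_nonneg hν i x) (edgeSum_pos hm i x).le
  -- The ratio r i is constant along edges in direction i, so ν may be replaced by m · r i, which
  -- has the same edge sums.
  have h1 : ∀ i, ∑ x, ν x * Real.log (r i x) = ∑ x, m x * (r i x * Real.log (r i x)) := by
    intro i
    have hinv : ∀ x s, r i (Function.update x i s) = r i x := fun x s => by
      simp only [hr, edgeSum_update]
    have e1 := sum_edgeSum_mul ν (fun x => Real.log (r i x)) i fun x s => by rw [hinv]
    have e2 := sum_edgeSum_mul m (fun x => r i x * Real.log (r i x)) i fun x s => by rw [hinv]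
    have e3 : ∀ x, edgeSum m i x * (r i x * Real.log (r i x)) =
        edgeSum ν i x * Real.log (r i x) := fun x => by
      rw [← mul_assoc, hr, mul_div_cancel₀ _ (edgeSum_pos hm i x).ne']
    rw [Finset.sum_congr rfl fun x _ => e3 x] at e2
    linarith
  rw [Finset.sum_congr rfl fun i _ => h1 i, Finset.sum_comm, Finset.mul_sum]
  refine Finset.sum_le_sum fun x _ => ?_
  have hn0 : (0 : ℝ) < n := by positivity
  -- After a Glauber step the density relative to m is the average of the r i; Jensen for t log t
  -- compares it with the down step.
  have hj := Real.convexOn_mul_log.map_sum_le (t := Finset.univ) (w := fun _ : Fin n => 1 / (n : ℝ))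
    (p := fun i => r i x) (fun _ _ => by positivity)
    (by simp [hn0.ne']) (fun i _ => hr0 i x)
  simp only [smul_eq_mul, ← Finset.mul_sum] at hj
  rw [vecMul_glauber, ← Finset.mul_sum, ← Finset.mul_sum, mul_left_comm,
    mul_div_cancel_left₀ _ (hm x).ne', mul_assoc, mul_left_comm (1 / (n : ℝ)) (m x)]
  exact mul_le_mul_of_nonneg_left hj (hm x).le

/-- Approximate tensorization of entropy gives contraction of relative entropy under the down
operator. -/
lemma relEntropy_downDist_le (hn : n ≠ 0) {ν m : Cube n → ℝ} (hm : ∀ x, 0 < m x)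
    (hm1 : ∑ x, m x = 1) (hν : ∀ x, 0 ≤ ν x) (hν1 : ∑ x, ν x = 1) {c : ℝ}
    (hc : ∀ f : Cube n → ℝ, (∀ x, 0 ≤ f x) → c * wEnt m f ≤ ∑ i, edgeEnt m f i) :
    relEntropy (downDist ν) (downDist m) ≤ ((1 - c / n : ℝ) : EReal) * relEntropy ν m := by
  rw [relEntropy_of_pos hm, relEntropy_downDist hn hm, ← EReal.coe_mul, EReal.coe_le_coe_iff]
  -- For the density f = ν/m the mean is 1, so the entropy is D(ν‖m) and the hypothesis reads c D ≤
  -- n D - ∑ D_i.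
  have h := hc (fun x => ν x / m x) fun x => div_nonneg (hν x) (hm x).le
  have e : ∀ x, m x * (ν x / m x) = ν x := fun x => mul_div_cancel₀ _ (hm x).ne'
  simp only [edgeEnt_eq, wEnt, ← mul_assoc, e, hν1, hm1, div_one, Real.log_one, mul_zero,
    sub_zero, Finset.sum_sub_distrib, Finset.sum_const, Finset.card_univ, Fintype.card_fin,
    nsmul_eq_mul] at h
  have hn0 : (0 : ℝ) < n := by positivity
  have h2 := mul_le_mul_of_nonneg_left h (one_div_pos.2 hn0).le
  set D := ∑ x, ν x * Real.log (ν x / m x)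
  have e1 : 1 / (n : ℝ) * (n * D) = D := by field_simp
  rw [mul_sub, e1] at h2
  have e2 : (1 - c / n) * D = D - 1 / (n : ℝ) * (c * D) := by ring
  rw [e2]
  linarith

/-! ### The Dirichlet form -/

/-- Jensen for the concave logarithm under each conditional distribution. -/
lemma sum_glauber_mul_log_le {m g : Cube n → ℝ} (hm : ∀ x, 0 < m x) (hg : ∀ x, 0 < g x)
    (x : Cube n) :
    ∑ y, glauber m x y * Real.log (g y) ≤
      (1 / (n : ℝ)) * ∑ i, Real.log (edgeSum (fun y => m y * g y) i x / edgeSum m i x) := by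
  rw [sum_glauber_mul]
  refine mul_le_mul_of_nonneg_left (Finset.sum_le_sum fun i _ => ?_) (by positivity)
  have hM := edgeSum_pos hm i x
  have hj := strictConcaveOn_log_Ioi.concaveOn.le_map_sum (t := Finset.univ)
    (w := fun s : ℤˣ => m (Function.update x i s) / edgeSum m i x)
    (p := fun s => g (Function.update x i s)) (fun s _ => (div_pos (hm _) hM).le)
    (by rw [← Finset.sum_div]; exact div_self hM.ne') (fun s _ => hg _)
  simp only [smul_eq_mul, div_mul_eq_mul_div, ← Finset.sum_div] at hj
  exact hj

lemma ereal_coe_sum {ι : Type*} (s : Finset ι) (F : ι → ℝ) :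
    ((∑ i ∈ s, F i : ℝ) : EReal) = ∑ i ∈ s, (F i : EReal) := by
  classical
  induction s using Finset.induction_on with
  | empty => simp
  | insert a s ha ih => rw [Finset.sum_insert ha, Finset.sum_insert ha, EReal.coe_add, ih]

/-- If f vanishes at a neighbour of x the left side is -∞, so f is raised to f + ε and ε → 0. The
right side has a real limit because f x ≠ 0 keeps every edge sum through x positive. -/
lemma ereal_sum_glauber_mul_log_le {m : Cube n → ℝ} (hm : ∀ x, 0 < m x) (f : Cube n → ℝ≥0)
    {x : Cube n} (hx : f x ≠ 0) :
    ∑ y, ((glauber m x y : ℝ) : EReal) * ENNReal.log (f y : ℝ≥0∞) ≤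
      (((1 / (n : ℝ)) * ∑ i, Real.log
        (edgeSum (fun y => m y * (f y : ℝ)) i x / edgeSum m i x) : ℝ) : EReal) := by
  have hx0 : (0 : ℝ) < f x := by positivity
  have hpos : ∀ i, 0 < edgeSum (fun y => m y * (f y : ℝ)) i x := fun i =>
    Finset.sum_pos' (fun s _ => mul_nonneg (hm _).le (f _).2)
      ⟨x i, Finset.mem_univ _, by simpa using mul_pos (hm x) hx0⟩
  have hlim : Filter.Tendsto (fun ε : ℝ≥0 => (((1 / (n : ℝ)) * ∑ i, Real.log
      (edgeSum (fun y => m y * ((f y + ε : ℝ≥0) : ℝ)) i x / edgeSum m i x) : ℝ) : EReal))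
      (nhdsWithin 0 (Set.Ioi 0)) (nhds (((1 / (n : ℝ)) * ∑ i, Real.log
        (edgeSum (fun y => m y * (f y : ℝ)) i x / edgeSum m i x) : ℝ) : EReal)) := by
    refine (continuous_coe_real_ereal.tendsto _).comp ((tendsto_finsetSum _ fun i _ => ?_).const_mul
      (1 / (n : ℝ)))
    refine Filter.Tendsto.log ?_ (div_pos (hpos i) (edgeSum_pos hm i x)).ne'
    have hcont : Continuous fun ε : ℝ≥0 =>
        edgeSum (fun y => m y * ((f y + ε : ℝ≥0) : ℝ)) i x / edgeSum m i x := by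
      unfold edgeSum
      fun_prop
    simpa using (hcont.tendsto 0).mono_left nhdsWithin_le_nhds
  refine ge_of_tendsto hlim ?_
  filter_upwards [self_mem_nhdsWithin] with ε hε
  have hε0 : ∀ y, 0 < f y + ε := fun y => add_pos_of_nonneg_of_pos zero_le hε
  have h1 := sum_glauber_mul_log_le hm (g := fun y => ((f y + ε : ℝ≥0) : ℝ))
    (fun y => NNReal.coe_pos.2 (hε0 y)) x
  refine le_trans ?_ (EReal.coe_le_coe_iff.2 h1)
  rw [ereal_coe_sum]
  refine Finset.sum_le_sum fun y _ => ?_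
  rw [EReal.coe_mul, ← ENNReal.log_of_nnreal (hε0 y).ne']
  refine mul_le_mul_of_nonneg_left (ENNReal.log_le_log ?_)
    (EReal.coe_nonneg.2 (glauber_nonneg hm x y))
  exact ENNReal.coe_le_coe.2 le_self_add

/-- The Dirichlet form of the Glauber dynamics dominates the average entropy along the edges. -/
lemma sum_edgeEnt_le_dirichletLog (hn : n ≠ 0) {m : Cube n → ℝ} (hm : ∀ x, 0 < m x)
    (f : Cube n → ℝ≥0) :
    (((1 / (n : ℝ)) * ∑ i, edgeEnt m (fun x => (f x : ℝ)) i : ℝ) : EReal) ≤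
      dirichletLog m (glauber m) f := by
  set r : Cube n → ℝ := fun x => (1 / (n : ℝ)) * ∑ i, Real.log
    (edgeSum (fun y => m y * (f y : ℝ)) i x / edgeSum m i x) with hr
  have e : (1 / (n : ℝ)) * ∑ i, edgeEnt m (fun x => (f x : ℝ)) i =
      ∑ x, m x * (f x : ℝ) * (Real.log (f x) - r x) := by
    simp only [edgeEnt_eq, Finset.sum_sub_distrib, mul_sub, Finset.sum_const, Finset.card_univ,
      Fintype.card_fin, nsmul_eq_mul]
    have hn0 : (n : ℝ) ≠ 0 := by positivity
    congr 1
    · rw [← mul_assoc, one_div_mul_cancel hn0, one_mul]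
      exact Finset.sum_congr rfl fun x _ => (mul_assoc _ _ _).symm
    · rw [Finset.sum_comm, Finset.mul_sum]
      refine Finset.sum_congr rfl fun x _ => ?_
      rw [hr, ← Finset.mul_sum, mul_left_comm]
  rw [e, ereal_coe_sum, dirichletLog]
  refine Finset.sum_le_sum fun x _ => ?_
  rcases eq_or_ne (f x) 0 with hx | hx
  -- The infinite logarithm is multiplied by 0 here, and the convention 0 · (±∞) = 0 makes both
  -- summands vanish.
  · simp [hx]
  · rw [EReal.coe_mul (m x * f x)]
    refine mul_le_mul_of_nonneg_left ?_ (EReal.coe_nonneg.2 (mul_nonneg (hm x).le (f x).2))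
    rw [EReal.coe_sub, ENNReal.log_of_nnreal hx]
    exact EReal.sub_le_sub le_rfl (ereal_sum_glauber_mul_log_le hm f hx)

lemma le_mlsiConstant_glauber (hn : n ≠ 0) {m : Cube n → ℝ} (hm : ∀ x, 0 < m x)
    (hm1 : ∑ x, m x = 1) {c : ℝ}
    (hc : ∀ f : Cube n → ℝ, (∀ x, 0 ≤ f x) → c * wEnt m f ≤ ∑ i, edgeEnt m f i) :
    ((c / (2 * n) : ℝ) : EReal) ≤ mlsiConstant m (glauber m) := by
  refine le_iInf₂ fun f hf => ?_
  have he : entropy m f = wEnt m fun x => (f x : ℝ) := by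
    rw [entropy, wEnt, hm1, div_one]
  have hpos : 0 < entropy m f :=
    lt_of_le_of_ne (he ▸ wEnt_nonneg (fun x => (hm x).le) fun x => (f x).2) hf.symm
  rw [EReal.le_div_iff_mul_le (EReal.coe_pos.2 (by positivity)) (EReal.coe_ne_top _),
    ← EReal.coe_mul]
  refine le_trans (EReal.coe_le_coe_iff.2 ?_) (sum_edgeEnt_le_dirichletLog hn hm f)
  have h1 := mul_le_mul_of_nonneg_left (hc (fun x => (f x : ℝ)) fun x => (f x).2)
    (by positivity : 0 ≤ 1 / (n : ℝ))
  rw [← he] at h1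
  refine le_trans (le_of_eq ?_) h1
  have hn0 : (n : ℝ) ≠ 0 := by positivity
  field_simp

end Edges

/-! ### The rank-one Ising model -/

lemma sum_isingWeight_pos {n : ℕ} (u h : EuclideanSpace ℝ (Fin n)) :
    0 < ∑ x, isingWeight u h x :=
  Finset.sum_pos (fun x _ => isingWeight_pos u h x) Finset.univ_nonempty

lemma ising_pos {n : ℕ} (u h : EuclideanSpace ℝ (Fin n)) (x : Cube n) : 0 < ising u h x :=
  div_pos (isingWeight_pos u h x) (sum_isingWeight_pos u h)

lemma sum_ising {n : ℕ} (u h : EuclideanSpace ℝ (Fin n)) : ∑ x, ising u h x = 1 := by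
  simp only [ising, ← Finset.sum_div]
  exact div_self (sum_isingWeight_pos u h).ne'

lemma wEnt_ising_le {n : ℕ} (u h : EuclideanSpace ℝ (Fin n)) (f : Cube n → ℝ)
    (hf : ∀ x, 0 ≤ f x) :
    (1 - ‖u‖ ^ 2) * wEnt (ising u h) f ≤ ∑ i, edgeEnt (ising u h) f i := by
  have e : ising u h = fun x => (∑ y, isingWeight u h y)⁻¹ * isingWeight u h x :=
    funext fun x => by rw [ising, div_eq_inv_mul]
  rw [e, wEnt_smul]
  simp only [edgeEnt_smul]
  rw [← Finset.mul_sum, mul_left_comm]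
  exact mul_le_mul_of_nonneg_left (wEnt_isingWeight_le u h hf)
    (inv_nonneg.2 (sum_isingWeight_pos u h).le)

end RankOneIsing

theorem mainTheorem4 (n : ℕ) (hn : 2 ≤ n) (u h : EuclideanSpace ℝ (Fin n)) :
    (∀ ν ∈ stdSimplex ℝ (RankOneIsing.Cube n),
      RankOneIsing.relEntropy
          (Matrix.vecMul ν (RankOneIsing.glauber (RankOneIsing.ising u h)))
          (Matrix.vecMul (RankOneIsing.ising u h) (RankOneIsing.glauber (RankOneIsing.ising u h)))
        ≤ RankOneIsing.relEntropy
          (RankOneIsing.downDist ν) (RankOneIsing.downDist (RankOneIsing.ising u h)) ∧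
      RankOneIsing.relEntropy
          (RankOneIsing.downDist ν) (RankOneIsing.downDist (RankOneIsing.ising u h))
        ≤ ((1 - (1 - ‖u‖ ^ 2) / n : ℝ) : EReal) *
          RankOneIsing.relEntropy ν (RankOneIsing.ising u h)) ∧
    (((1 - ‖u‖ ^ 2) / (2 * n) : ℝ) : EReal) ≤
      RankOneIsing.mlsiConstant (RankOneIsing.ising u h)
        (RankOneIsing.glauber (RankOneIsing.ising u h)) := by
  have hn0 : n ≠ 0 := by omega
  have hm := RankOneIsing.ising_pos u h
  have hm1 := RankOneIsing.sum_ising u h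
  have hc := RankOneIsing.wEnt_ising_le u h
  exact ⟨fun ν hν => ⟨RankOneIsing.relEntropy_vecMul_glauber_le hn0 hm hν.1,
    RankOneIsing.relEntropy_downDist_le hn0 hm hm1 hν.1 hν.2 hc⟩,
    RankOneIsing.le_mlsiConstant_glauber hn0 hm hm1 hc⟩
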